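/- An action of \(a\) and \(b\) on a \(\mathbb{C}[[b]]\)-module \(E\) is given by a \(\mathbb{C}\)-linear map \(a:E\to E\) with \(a(Sx)=S\,a(x)+b^2S'x\) for all \(S\in\mathbb{C}[[b]]\), \(x\in E\). Below, submodules are \(a\)-stable \(\mathbb{C}[[b]]\)-submodules, and morphisms are \(\mathbb{C}[[b]]\)-linear maps commuting with \(a\). An (a,b)-module is such an \(E\) which is free of finite rank over \(\mathbb{C}[[b]]\). It has a simple pole if \(aE\subset bE\); it is regular if it embeds in an (a,b)-module with a simple pole, and then \(E^\sharp\) denotes the smallest simple pole (a,b)-module containing it. The Bernstein polynomial of a regular \(E\) is the minimal polynomial of \(-b^{-1}a\) acting on \(E^\sharp/bE^\sharp\); for \(\lambda\in\mathbb{Q}\cap\,]0,1]\), \(E\) is \([\lambda]\)-primitive if all roots of this polynomial lie in \(-\lambda+\mathbb{Z}\). The module \(E\) is semi-simple if it is isomorphic to a submodule of a finite direct sum of regular (a,b)-modules of rank one. A fresco is a module isomorphic to the submodule generated by one element of \(\Xi_\Lambda^{(N)}\otimes_{\mathbb C} V\), where \(\Lambda\subset\mathbb{Q}\cap\,]0,1]\)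 is finite, \(N\in\mathbb{N}\), \(V\) is a finite dimensional complex vector space, and \(\Xi_\Lambda^{(N)}=\bigoplus_{\lambda\in\Lambda}\bigoplus_{j=0}^N\mathbb{C}[[b]]\,s^{\lambda-1}(\log s)^j\) is the module of formal asymptotic expansions on which \(a\) is multiplication by \(s\) and \(b\) is the primitive in \(s\) without constant term. For \(\mu\in\mathbb{C}\) let \(E_\mu=\mathbb{C}[[b]]\,e_\mu\) with \(a\,e_\mu=\mu\,b\,e_\mu\). A Jordan–Hölder sequence of \(E\) is a sequence \(0=F_0\subset F_1\subset\dots\subset F_k=E\) of submodules which are normal (\(F_j\cap bE=bF_j\)) with all quotients \(F_j/F_{j-1}\) of rank one; it corresponds to the numbers \(\mu_1,\dots,\mu_k\) if \(F_j/F_{j-1}\simeq E_{\mu_j}\) for all \(j\in[1,k]\). A sequence \(\mu_1,\dots,\mu_k\) is a twisted permutation of \(\nu_1,\dots,\nu_k\) if the sequence \((\mu_j+j)_{j\in[1,k]}\) is a permutation of \((\nu_j+j)_{j\in[1,k]}\). Proposition. (1) Let \(\lambda\in\mathbb{Q}\cap\,]0,1]\) and let \(E\) be a \([\lambda]\)-primitive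 fresco. Then \(E\) is semi-simple if and only if it admits a Jordan–Hölder sequence corresponding to rational numbers \(\mu_1,\dots,\mu_k\) such that the sequence \(\mu_j+j\), \(j\in[1,k]\), is strictly decreasing. (2) Let \(E\) be a semi-simple fresco. Then \(E\) admits a Jordan–Hölder sequence with associated numbers, and whenever \(\nu_1,\dots,\nu_k\) are the numbers corresponding to some Jordan–Hölder sequence of \(E\) and \(\mu_1,\dots,\mu_k\) is a twisted permutation of \(\nu_1,\dots,\nu_k\), there exists a Jordan–Hölder sequence of \(E\) corresponding to \(\mu_1,\dots,\mu_k\). -/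

import Mathlib

open scoped PowerSeries

noncomputable section

namespace ABTheory

/-- The action of the operators `a` and `b` on `E`.  The variable `X` of `ℂ⟦X⟧` acts as `b`, and `a` is a
`ℂ`-linear endomorphism with `a ∘ S = S ∘ a + b² S'` for `S ∈ ℂ[[b]]` (in particular `ab - ba = b²`). -/
class ABAction (E : Type*) [AddCommGroup E] [Module ℂ E] [Module ℂ⟦X⟧ E]
    [IsScalarTower ℂ ℂ⟦X⟧ E] where
  a : E →ₗ[ℂ] E
  a_smul : ∀ (S : ℂ⟦X⟧) (x : E),
    a (S • x) = S • a x + ((PowerSeries.X : ℂ⟦X⟧) ^ 2 * PowerSeries.derivative ℂ S) • x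

open ABAction (a)

/-- An (a,b)-module: a free `ℂ[[b]]`-module of finite rank with an operator `a` as above.
Every free `ℂ[[b]]`-module of finite rank is isomorphic to some `ℂ[[b]]ⁿ`, so that the universe `Type`
contains all (a,b)-modules up to isomorphism. -/
structure ABModule where
  carrier : Type
  [addCommGroup : AddCommGroup carrier]
  [moduleC : Module ℂ carrier]
  [moduleCb : Module ℂ⟦X⟧ carrier]
  [tower : IsScalarTower ℂ ℂ⟦X⟧ carrier]
  [action : ABAction carrier]
  [free : Module.Free ℂ⟦X⟧ carrier]
  [finite : Module.Finite ℂ⟦X⟧ carrier]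

instance : CoeSort ABModule Type := ⟨ABModule.carrier⟩

attribute [instance] ABModule.addCommGroup ABModule.moduleC ABModule.moduleCb ABModule.tower
  ABModule.action ABModule.free ABModule.finite

section General

variable (E : Type*) [AddCommGroup E] [Module ℂ E] [Module ℂ⟦X⟧ E] [IsScalarTower ℂ ℂ⟦X⟧ E]
  [ABAction E]
variable (F : Type*) [AddCommGroup F] [Module ℂ F] [Module ℂ⟦X⟧ F] [IsScalarTower ℂ ℂ⟦X⟧ F]
  [ABAction F]

/-- Morphisms: `ℂ[[b]]`-linear maps that commute with `a`. -/
structure ABHom extends E →ₗ[ℂ⟦X⟧] F where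
  map_a : ∀ x, toFun (a x) = a (toFun x)

/-- Isomorphisms: bijective `ℂ[[b]]`-linear maps that commute with `a`. -/
structure ABIso extends E ≃ₗ[ℂ⟦X⟧] F where
  map_a : ∀ x, toFun (a x) = a (toFun x)

/-- Submodules: `ℂ[[b]]`-submodules that are stable under `a`. -/
structure ABSub extends Submodule ℂ⟦X⟧ E where
  a_mem : ∀ x ∈ carrier, a x ∈ carrier

variable {E}

instance (G : ABSub E) : ABAction G.toSubmodule where
  a := ((a : E →ₗ[ℂ] E).comp (G.toSubmodule.subtype.restrictScalars ℂ)).codRestrict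
    (G.toSubmodule.restrictScalars ℂ) (fun x => G.a_mem x.1 x.2)
  a_smul S x := Subtype.ext (ABAction.a_smul S x.1)

instance (G : ABSub E) : ABAction (E ⧸ G.toSubmodule) where
  a := (G.toSubmodule.restrictScalars ℂ).mapQ (G.toSubmodule.restrictScalars ℂ) a
    (fun x hx => G.a_mem x hx)
  a_smul S x := by
    obtain ⟨y, rfl⟩ := G.toSubmodule.mkQ_surjective x
    exact congrArg G.toSubmodule.mkQ (ABAction.a_smul S y)

/-- `G ∩ H`, regarded as a submodule of `H`. -/
def ABSub.inside (G H : ABSub E) : ABSub H.toSubmodule where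
  toSubmodule := G.toSubmodule.comap H.toSubmodule.subtype
  a_mem x hx := G.a_mem x.1 hx

/-- The quotient `H / G` (for `G ⊆ H`). -/
abbrev ABSub.Quot (H G : ABSub E) : Type _ := H.toSubmodule ⧸ (G.inside H).toSubmodule

/-- The submodule generated by one element `x`: the smallest submodule that contains `x`. -/
def ABSub.gen (x : E) : ABSub E where
  toSubmodule := sInf {G : Submodule ℂ⟦X⟧ E | x ∈ G ∧ ∀ y ∈ G, a y ∈ G}
  a_mem y hy := by
    change y ∈ sInf {G : Submodule ℂ⟦X⟧ E | x ∈ G ∧ ∀ y ∈ G, a y ∈ G} at hy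
    change a y ∈ sInf {G : Submodule ℂ⟦X⟧ E | x ∈ G ∧ ∀ y ∈ G, a y ∈ G}
    rw [Submodule.mem_sInf] at hy ⊢
    exact fun G hG => hG.2 y (hy G hG)

/-- A submodule `G` of `E` is normal when `G ∩ bE = bG`. -/
def ABSub.IsNormal (G : ABSub E) : Prop :=
  ∀ x : E, (x ∈ G.toSubmodule ∧ ∃ y : E, x = (PowerSeries.X : ℂ⟦X⟧) • y) ↔
    ∃ z ∈ G.toSubmodule, x = (PowerSeries.X : ℂ⟦X⟧) • z

variable (E)

/-- `E` has a simple pole: `aE ⊆ bE`. -/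
def HasSimplePole : Prop := ∀ x : E, ∃ y : E, a x = (PowerSeries.X : ℂ⟦X⟧) • y

/-- `E` is regular: it embeds in an (a,b)-module with a simple pole. -/
def IsRegular : Prop :=
  ∃ (M : ABModule) (i : ABHom E M), Function.Injective i.toLinearMap ∧ HasSimplePole M

/-- On a direct sum (of finitely many modules) `a` acts componentwise. -/
instance instPi {ι : Type*} (M : ι → Type*) [∀ i, AddCommGroup (M i)] [∀ i, Module ℂ (M i)]
    [∀ i, Module ℂ⟦X⟧ (M i)] [∀ i, IsScalarTower ℂ ℂ⟦X⟧ (M i)] [∀ i, ABAction (M i)] :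
    ABAction (∀ i, M i) where
  a := LinearMap.pi fun i => (a : M i →ₗ[ℂ] M i).comp (LinearMap.proj i)
  a_smul S x := funext fun i => ABAction.a_smul S (x i)

/-- `E` is semi-simple: it is isomorphic to a submodule of a finite direct sum of regular (a,b)-modules of rank
one. -/
def IsSemisimple : Prop :=
  ∃ (n : ℕ) (M : Fin n → ABModule),
    (∀ i, IsRegular (M i) ∧ Module.finrank ℂ⟦X⟧ (M i) = 1) ∧
    ∃ f : ABHom E (∀ i, M i), Function.Injective f.toLinearMap

/-- Multiplication by `b` as a `ℂ`-linear map. -/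
def bMap : E →ₗ[ℂ] E := DistribSMul.toLinearMap ℂ E (PowerSeries.X : ℂ⟦X⟧)

end General

section Bernstein

variable (M : ABModule)

theorem b_cancel {x y : M} (h : (PowerSeries.X : ℂ⟦X⟧) • x = (PowerSeries.X : ℂ⟦X⟧) • y) : x = y :=
  smul_right_injective M PowerSeries.X_ne_zero h

/-- The operator `b⁻¹a` on an (a,b)-module with a simple pole. -/
def bInvA (h : HasSimplePole M) : M →ₗ[ℂ] M where
  toFun x := (h x).choose
  map_add' x y := b_cancel M (by
    rw [← (h (x + y)).choose_spec, smul_add, ← (h x).choose_spec, ← (h y).choose_spec, map_add])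
  map_smul' c x := b_cancel M (by
    rw [← (h (c • x)).choose_spec, RingHom.id_apply, smul_comm, ← (h x).choose_spec, map_smul])

theorem b_bInvA (h : HasSimplePole M) (x : M) :
    (PowerSeries.X : ℂ⟦X⟧) • bInvA M h x = a x := (h x).choose_spec.symm

/-- The endomorphism of `M / bM` induced by `b⁻¹a`. -/
def bInvAQuot (h : HasSimplePole M) : Module.End ℂ (M ⧸ LinearMap.range (bMap M)) :=
  (LinearMap.range (bMap M)).mapQ (LinearMap.range (bMap M)) (bInvA M h) (by
    rintro _ ⟨x, rfl⟩
    refine ⟨bInvA M h x + x, b_cancel M ?_⟩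
    rw [b_bInvA]
    change (PowerSeries.X : ℂ⟦X⟧) • ((PowerSeries.X : ℂ⟦X⟧) • (bInvA M h x + x)) =
      a ((PowerSeries.X : ℂ⟦X⟧) • x)
    rw [ABAction.a_smul, smul_add, b_bInvA, smul_add, smul_smul, ← pow_two]
    simp)

/-- The Bernstein polynomial of an (a,b)-module with a simple pole: the minimal polynomial of `-b⁻¹a`
acting on `M / bM`. -/
def simplePoleBernstein (h : HasSimplePole M) : Polynomial ℂ := minpoly ℂ (-bInvAQuot M h)

variable (E : Type*) [AddCommGroup E] [Module ℂ E] [Module ℂ⟦X⟧ E] [IsScalarTower ℂ ℂ⟦X⟧ E]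
  [ABAction E]

/-- `i : E → M` is the saturation of `E` by `b⁻¹a`: it is the minimal embedding of `E` in an (a,b)-module
with a simple pole, that is, `i` is injective, `M` has a simple pole, and no proper submodule of `M`
with a simple pole contains the image of `E`. -/
def IsSaturation {E : Type*} [AddCommGroup E] [Module ℂ E] [Module ℂ⟦X⟧ E]
    [IsScalarTower ℂ ℂ⟦X⟧ E] [ABAction E] {M : ABModule} (i : ABHom E M) : Prop :=
  Function.Injective i.toLinearMap ∧ HasSimplePole M ∧
    ∀ G : ABSub M, HasSimplePole G.toSubmodule → LinearMap.range i.toLinearMap ≤ G.toSubmodule →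
      G.toSubmodule = ⊤

/-- `B` is the Bernstein polynomial of `E`, i.e. that of its saturation (which is unique up to isomorphism,
and exists exactly when `E` is a regular (a,b)-module). -/
def IsBernsteinPolynomial (B : Polynomial ℂ) : Prop :=
  ∃ (M : ABModule) (h : HasSimplePole M) (i : ABHom E M),
    IsSaturation i ∧ B = simplePoleBernstein M h

/-- `E` is a regular (a,b)-module which is `[Λ]`-primitive: all roots of its Bernstein polynomial
lie in `-Λ + ℤ`. -/
def IsPrimitive (Λ : Set ℚ) : Prop :=
  ∃ B : Polynomial ℂ, IsBernsteinPolynomial E B ∧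
    ∀ ρ : ℂ, B.IsRoot ρ → ∃ l ∈ Λ, ∃ n : ℤ, ρ = -(l : ℂ) + (n : ℂ)

end Bernstein

/-- The rank one module `E_μ`, the quotient of the algebra generated by `a` and `ℂ[[b]]` by the left ideal
generated by `a - μb`: it is `ℂ[[b]] e` with `a e = μ b e`. -/
def RankOne (_μ : ℂ) : Type := ℂ⟦X⟧

namespace RankOne

variable (μ : ℂ)

instance : AddCommGroup (RankOne μ) := inferInstanceAs (AddCommGroup ℂ⟦X⟧)
instance : Module ℂ (RankOne μ) := inferInstanceAs (Module ℂ ℂ⟦X⟧)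
instance : Module ℂ⟦X⟧ (RankOne μ) := inferInstanceAs (Module ℂ⟦X⟧ ℂ⟦X⟧)
instance : IsScalarTower ℂ ℂ⟦X⟧ (RankOne μ) := inferInstanceAs (IsScalarTower ℂ ℂ⟦X⟧ ℂ⟦X⟧)

/-- `a (S e) = (b² S' + μ b S) e`. -/
def aFun : ℂ⟦X⟧ →ₗ[ℂ] ℂ⟦X⟧ :=
  LinearMap.mulLeft ℂ (PowerSeries.X ^ 2) ∘ₗ (PowerSeries.derivative ℂ).toLinearMap
    + μ • LinearMap.mulLeft ℂ PowerSeries.X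

theorem aFun_mul (S T : ℂ⟦X⟧) :
    aFun μ (S * T) = S * aFun μ T + PowerSeries.X ^ 2 * PowerSeries.derivative ℂ S * T := by
  simp only [aFun, LinearMap.add_apply, LinearMap.comp_apply, LinearMap.smul_apply,
    LinearMap.mulLeft_apply, Derivation.coeFn_coe, Derivation.leibniz, smul_eq_mul, mul_add,
    mul_smul_comm]
  rw [mul_left_comm S PowerSeries.X T]
  ring

instance : ABAction (RankOne μ) where
  a := aFun μ
  a_smul S T := aFun_mul μ S T

end RankOne

/-- The module `Ξ_Λ^{(N)} ⊗ ℂ^p` of formal asymptotic expansions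
`∑_{l ∈ Λ} ∑_{j ≤ N} ℂ[[s]] s^{l-1} (log s)^j ⊗ ℂ^p`, on which `a` is the multiplication by `s` and `b` is
the primitive in `s` without constant term.  It is free over `ℂ[[b]]` with basis
`e_{l,j,v} = s^{l-1} (log s)^j ⊗ v`, `v` in the standard basis of `ℂ^p`; an element is given by its
coordinates in this basis.  As `d/ds (s · s^{l-1} (log s)^j) = l s^{l-1} (log s)^j + j s^{l-1} (log s)^{j-1}`,
one has `a e_{l,j,v} = b (l e_{l,j,v} + j e_{l,j-1,v})`. -/
def Xi (Λ : Finset ℚ) (N p : ℕ) : Type := Λ → Fin (N + 1) → Fin p → ℂ⟦X⟧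

namespace Xi

variable (Λ : Finset ℚ) (N p : ℕ)

instance : AddCommGroup (Xi Λ N p) :=
  inferInstanceAs (AddCommGroup (Λ → Fin (N + 1) → Fin p → ℂ⟦X⟧))
instance : Module ℂ (Xi Λ N p) :=
  inferInstanceAs (Module ℂ (Λ → Fin (N + 1) → Fin p → ℂ⟦X⟧))
instance : Module ℂ⟦X⟧ (Xi Λ N p) :=
  inferInstanceAs (Module ℂ⟦X⟧ (Λ → Fin (N + 1) → Fin p → ℂ⟦X⟧))
instance : IsScalarTower ℂ ℂ⟦X⟧ (Xi Λ N p) :=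
  inferInstanceAs (IsScalarTower ℂ ℂ⟦X⟧ (Λ → Fin (N + 1) → Fin p → ℂ⟦X⟧))

/-- The coordinates of `a (∑ f_{l,j,v} e_{l,j,v})`: the one at `(l,j,v)` is
`b² f_{l,j,v}' + l b f_{l,j,v} + (j+1) b f_{l,j+1,v}`, where `f_{l,N+1,v} = 0`. -/
def aFun (f : Λ → Fin (N + 1) → Fin p → ℂ⟦X⟧) : Λ → Fin (N + 1) → Fin p → ℂ⟦X⟧ :=
  fun l j v =>
    PowerSeries.X ^ 2 * PowerSeries.derivative ℂ (f l j v)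
      + PowerSeries.C ((l : ℚ) : ℂ) * (PowerSeries.X * f l j v)
      + if h : (j : ℕ) + 1 < N + 1 then
          PowerSeries.C ((j : ℂ) + 1) * (PowerSeries.X * f l ⟨j + 1, h⟩ v) else 0

instance : ABAction (Xi Λ N p) where
  a :=
    { toFun := aFun Λ N p
      map_add' := fun f g => by
        funext l j v
        change aFun Λ N p (fun l j v => f l j v + g l j v) l j v
          = aFun Λ N p f l j v + aFun Λ N p g l j v
        simp only [aFun, map_add]
        split_ifs <;> ring
      map_smul' := fun c f => by
        funext l j v
        change aFun Λ N p (fun l j v => c • f l j v) l j v = c • aFun Λ N p f l j v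
        simp only [aFun, Derivation.map_smul]
        simp only [PowerSeries.smul_eq_C_mul]
        split_ifs <;> ring }
  a_smul S f := by
    funext l j v
    change aFun Λ N p (fun l j v => S * f l j v) l j v
      = S * aFun Λ N p f l j v + (PowerSeries.X ^ 2 * PowerSeries.derivative ℂ S) * f l j v
    simp only [aFun, Derivation.leibniz, smul_eq_mul]
    split_ifs <;> ring

end Xi

section Main

variable (E : Type*) [AddCommGroup E] [Module ℂ E] [Module ℂ⟦X⟧ E] [IsScalarTower ℂ ℂ⟦X⟧ E]
  [ABAction E]

/-- `E` is a fresco: it is isomorphic to the submodule generated by one element `φ` of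
`Ξ_Λ^{(N)} ⊗ V`, for a finite subset `Λ` of `ℚ ∩ ]0,1]`, some `N`, and a finite dimensional complex
vector space `V` (which may be taken to be `ℂ^p`). -/
def IsFresco : Prop :=
  ∃ (Λ : Finset ℚ) (N p : ℕ) (φ : Xi Λ N p), (∀ l ∈ Λ, 0 < l ∧ l ≤ 1) ∧
    Nonempty (ABIso E (ABSub.gen φ).toSubmodule)

variable {E}

/-- `0 = F_0 ⊆ F_1 ⊆ ⋯ ⊆ F_k = E` is a Jordan–Hölder sequence: the `F_j` are normal submodules
and the quotients `F_j / F_{j-1}` have rank one. -/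
def IsJordanHolder {k : ℕ} (F : Fin (k + 1) → ABSub E) : Prop :=
  (F 0).toSubmodule = ⊥ ∧ (F (Fin.last k)).toSubmodule = ⊤ ∧
  (∀ j : Fin k, (F j.castSucc).toSubmodule ≤ (F j.succ).toSubmodule) ∧
  (∀ j, (F j).IsNormal) ∧
  ∀ j : Fin k, Module.finrank ℂ⟦X⟧ ((F j.succ).Quot (F j.castSucc)) = 1

/-- The complex numbers `μ_1, …, μ_k` are associated to the Jordan–Hölder sequence `F`:
`F_j / F_{j-1} ≃ E_{μ_j}`.  (Here `μ j`, for `j : Fin k`, stands for `μ_{j+1}`.) -/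
def IsJordanHolderWith {k : ℕ} (F : Fin (k + 1) → ABSub E) (μ : Fin k → ℂ) : Prop :=
  IsJordanHolder F ∧ ∀ j : Fin k, Nonempty (ABIso ((F j.succ).Quot (F j.castSucc)) (RankOne (μ j)))

end Main

/-- `μ` is a twisted permutation of `ν`: the sequence `μ_j + j` (`j = 1, …, k`) is a permutation of the
sequence `ν_j + j`. -/
def IsTwistedPermutation {k : ℕ} (ν μ : Fin k → ℂ) : Prop :=
  ∃ σ : Equiv.Perm (Fin k), ∀ j : Fin k,
    μ j + ((j : ℕ) + 1 : ℂ) = ν (σ j) + ((σ j : ℕ) + 1 : ℂ)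

end ABTheory

end

/-!
A morphism to `E_ρ` which maps the generator `φ` of a module to a series of order `n` is `bⁿ` times
a morphism to `E_{ρ+n}` which maps `φ` to a generator. Two such morphisms with the same number
`ρ + n` have a combination whose value at `φ` is divisible by `b`, so it factors through
`E_{ρ+n+1}`. Hence a semi-simple module generated by `φ` embeds in a sum of modules `E_ρ`, with `ρ`
in a finite set `Λ` of pairwise distinct numbers, in which every component of `φ` is a unit.

For a suitable series `T` the operator `a - bT` kills the component of `φ` at a given `ρ ∈ Λ`. It
raises the order of every other component by exactly one, because its number is not `ρ`. Therefore
the kernel of the `ρ`-th component is again generated by one element, with set of numbers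
`Λ \ {ρ}` and components of order one, and this can be repeated. Removing the elements of `Λ` in any
order gives a Jordan–Hölder sequence, and every Jordan–Hölder sequence arises in this way: its
numbers are those for which `μ_j + j - k` enumerates `Λ`. This explains the twisted permutations. In
a fresco the members of `Λ` are rational, because for each `ρ ∈ Λ` some eigenvector of `b⁻¹a` has an
eigenvalue in `ρ + ℕ`, and the eigenvalues of `b⁻¹a` on the modules of asymptotic expansions are
rational. Taking them in decreasing order gives the sequence in (1).

Conversely, if `H / G ≃ E_ν`, then `b` times a morphism `G → E_ρ` extends to a morphism
`H → E_{ρ-1}` as soon as `ν ∉ ρ - 1 + ℕ`. When `μ_j + j` is strictly decreasing this condition holds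
at each step of the Jordan–Hölder sequence.
-/

noncomputable section

namespace ABTheory

open ABAction (a)
open PowerSeries

section Order

theorem order_eq_natCast_iff {R : Type*} [Semiring R] {S : R⟦X⟧} {n : ℕ} :
    S.order = n ↔ ∃ U : R⟦X⟧, constantCoeff U ≠ 0 ∧ S = X ^ n * U := by
  rw [order_eq_nat]
  refine ⟨fun ⟨hn, hlt⟩ => ?_, ?_⟩
  · obtain ⟨U, rfl⟩ := X_pow_dvd_iff.2 hlt
    exact ⟨U, by simpa [coeff_X_pow_mul'] using hn, rfl⟩
  · rintro ⟨U, hU, rfl⟩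
    exact ⟨by simpa [coeff_X_pow_mul'] using hU, fun i hi => by simp [coeff_X_pow_mul', hi]⟩

theorem order_eq_zero_iff {R : Type*} [Semiring R] {S : R⟦X⟧} :
    S.order = 0 ↔ constantCoeff S ≠ 0 := by
  simpa using order_eq_nat (φ := S) (n := 0)

theorem ne_zero_of_order_eq_natCast {R : Type*} [Semiring R] {S : R⟦X⟧} {n : ℕ}
    (h : S.order = n) : S ≠ 0 :=
  fun h0 => ENat.natCast_ne_top n (h.symm.trans (order_eq_top.2 h0))

theorem exists_order_eq_natCast {R : Type*} [Semiring R] {S : R⟦X⟧} (h : S ≠ 0) :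
    ∃ n : ℕ, S.order = n :=
  ⟨_, (coe_toNat_order h).symm⟩

theorem exists_derivative_eq_mul {K : Type*} [Field K] [CharZero K] (g : K⟦X⟧) :
    ∃ V : K⟦X⟧, constantCoeff V ≠ 0 ∧ PowerSeries.derivative K V = g * V := by
  let G : K⟦X⟧ := X * PowerSeries.mk fun n => coeff n g / ((n : K) + 1)
  have hG : HasSubst G := HasSubst.of_constantCoeff_zero' (by simp [G])
  have derivative_G : PowerSeries.derivative K G = g := by
    ext n
    rw [coeff_derivative, coeff_succ_X_mul, coeff_mk,
      div_mul_cancel₀ _ (Nat.cast_add_one_ne_zero n)]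
  have isUnit_exp_G : IsUnit ((exp K).subst G) := by
    have := (isUnit_exp K).map (substAlgHom (R := K) hG)
    rwa [coe_substAlgHom] at this
  refine ⟨(exp K).subst G, (isUnit_iff_constantCoeff.1 isUnit_exp_G).ne_zero, ?_⟩
  rw [derivative_subst hG, derivative_exp, derivative_G, mul_comm]

end Order

namespace RankOne

variable {μ : ℂ} {S T : ℂ⟦X⟧} {n : ℕ}

theorem aFun_apply (μ : ℂ) (S : ℂ⟦X⟧) :
    aFun μ S = X ^ 2 * PowerSeries.derivative ℂ S + C μ * (X * S) := by
  simp [aFun, PowerSeries.smul_eq_C_mul]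

theorem aFun_X_pow_mul (μ : ℂ) (n : ℕ) (S : ℂ⟦X⟧) :
    aFun μ (X ^ n * S) = X ^ n * aFun (μ + n) S := by
  induction n with
  | zero => simp
  | succ n ih =>
    rw [pow_succ', mul_assoc, aFun_mul, ih, derivative_X, aFun_apply, aFun_apply]
    push_cast
    simp only [map_add, map_one]
    ring

theorem coeff_zero_aFun (μ : ℂ) (S : ℂ⟦X⟧) : coeff 0 (aFun μ S) = 0 := by
  simp [aFun_apply]

theorem coeff_succ_aFun (μ : ℂ) (S : ℂ⟦X⟧) (n : ℕ) :
    coeff (n + 1) (aFun μ S) = ((n : ℂ) + μ) * coeff n S := by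
  rw [aFun_apply, map_add, pow_two, mul_assoc, coeff_succ_X_mul, coeff_C_mul, coeff_succ_X_mul]
  cases n with
  | zero => simp
  | succ n =>
    rw [coeff_succ_X_mul, coeff_derivative]
    push_cast
    ring

theorem aFun_X_pow_mul_sub (μ : ℂ) (n : ℕ) (T U : ℂ⟦X⟧) :
    aFun μ (X ^ n * U) - X * T * (X ^ n * U) =
      X ^ (n + 1) * (X * PowerSeries.derivative ℂ U + (C (μ + n) - T) * U) := by
  rw [aFun_X_pow_mul, aFun_apply]
  ring

theorem order_aFun_sub (hS : S.order = n) (hT : constantCoeff T ≠ μ + n) :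
    (aFun μ S - X * T * S).order = ((n + 1 : ℕ) : ℕ∞) := by
  obtain ⟨U, hU, rfl⟩ := order_eq_natCast_iff.1 hS
  refine order_eq_natCast_iff.2 ⟨_, ?_, aFun_X_pow_mul_sub μ n T U⟩
  simpa [hU, sub_eq_zero] using hT.symm

theorem constantCoeff_eq_of_aFun_eq (hS : S.order = n) (h : aFun μ S = X * T * S) :
    constantCoeff T = μ + n := by
  by_contra hT
  exact ne_zero_of_order_eq_natCast (order_aFun_sub hS hT) (sub_eq_zero.2 h)

theorem exists_aFun_eq_mul_self (μ : ℂ) (hS : S.order = n) :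
    ∃ T : ℂ⟦X⟧, constantCoeff T = μ + n ∧ aFun μ S = X * T * S := by
  obtain ⟨U, hU, rfl⟩ := order_eq_natCast_iff.1 hS
  refine ⟨C (μ + n) + X * PowerSeries.derivative ℂ U * U⁻¹, by simp, ?_⟩
  rw [← sub_eq_zero, aFun_X_pow_mul_sub]
  linear_combination
    (-X ^ (n + 1) * X * PowerSeries.derivative ℂ U) * PowerSeries.inv_mul_cancel U hU

theorem exists_aFun_constantCoeff_eq (T : ℂ⟦X⟧) :
    ∃ V : ℂ⟦X⟧, constantCoeff V ≠ 0 ∧ aFun (constantCoeff T) V = X * T * V := by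
  obtain ⟨g, hg⟩ : X ∣ T - C (constantCoeff T) := X_dvd_iff.2 (by simp)
  obtain ⟨V, hV, hdV⟩ := exists_derivative_eq_mul g
  refine ⟨V, hV, ?_⟩
  rw [aFun_apply, hdV]
  linear_combination (-X * V) * hg

theorem exists_aFun_eq_add {ρ ν : ℂ} (h : ∀ n : ℕ, n + ρ ≠ ν) (S : ℂ⟦X⟧) :
    ∃ u : ℂ⟦X⟧, aFun ρ u = C ν * X * u + X * S := by
  refine ⟨PowerSeries.mk fun n => coeff n S / (n + ρ - ν), ?_⟩
  ext n
  cases n with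
  | zero => simp [coeff_zero_aFun]
  | succ n =>
    rw [coeff_succ_aFun, map_add, mul_assoc, coeff_C_mul, coeff_succ_X_mul, coeff_succ_X_mul,
      coeff_mk]
    field_simp [sub_ne_zero.2 (h n)]
    ring

end RankOne

section Gen

variable {E : Type*} [AddCommGroup E] [Module ℂ E] [Module ℂ⟦X⟧ E] [IsScalarTower ℂ ℂ⟦X⟧ E]
  [ABAction E]
variable {F : Type*} [AddCommGroup F] [Module ℂ F] [Module ℂ⟦X⟧ F] [IsScalarTower ℂ ℂ⟦X⟧ F]
  [ABAction F]

namespace ABSub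

theorem toSubmodule_injective :
    Function.Injective (toSubmodule : ABSub E → Submodule ℂ⟦X⟧ E) := by
  rintro ⟨G, _⟩ ⟨H, _⟩ rfl
  rfl

theorem mem_gen (x : E) : x ∈ (gen x).toSubmodule :=
  Submodule.mem_sInf.2 fun _ hG => hG.1

theorem gen_le {x : E} {G : Submodule ℂ⟦X⟧ E} (hx : x ∈ G) (ha : ∀ y ∈ G, a y ∈ G) :
    (gen x).toSubmodule ≤ G :=
  sInf_le ⟨hx, ha⟩

theorem a_sub_smul_mem (G : ABSub E) (S : ℂ⟦X⟧) {x : E} (hx : x ∈ G.toSubmodule) :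
    a x - S • x ∈ G.toSubmodule :=
  sub_mem (G.a_mem x hx) (G.toSubmodule.smul_mem S hx)

theorem gen_le_span_sup_gen_a_sub (x : E) (S : ℂ⟦X⟧) :
    (gen x).toSubmodule ≤ (ℂ⟦X⟧ ∙ x) ⊔ (gen (a x - S • x)).toSubmodule := by
  have x_mem : x ∈ (ℂ⟦X⟧ ∙ x) ⊔ (gen (a x - S • x)).toSubmodule :=
    Submodule.mem_sup_left (Submodule.mem_span_singleton_self x)
  refine gen_le x_mem fun y hy => ?_
  obtain ⟨_, hu, g, hg, rfl⟩ := Submodule.mem_sup.1 hy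
  obtain ⟨R, rfl⟩ := Submodule.mem_span_singleton.1 hu
  have a_smul_x :
      a (R • x) = (R * S + X ^ 2 * PowerSeries.derivative ℂ R) • x + R • (a x - S • x) := by
    rw [ABAction.a_smul, add_smul, smul_sub, mul_smul R S]
    abel
  rw [map_add, a_smul_x]
  exact add_mem (add_mem (Submodule.smul_mem _ _ x_mem)
    (Submodule.mem_sup_right (Submodule.smul_mem _ _ (mem_gen _))))
    (Submodule.mem_sup_right ((gen _).a_mem g hg))

theorem eq_gen_a_sub {G : ABSub E} {x : E} {S : ℂ⟦X⟧}
    (hle : G.toSubmodule ≤ (gen x).toSubmodule) (hx : a x - S • x ∈ G.toSubmodule)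
    (hsmul : ∀ R : ℂ⟦X⟧, R • x ∈ G.toSubmodule → R = 0) : G = gen (a x - S • x) := by
  have hge : (gen (a x - S • x)).toSubmodule ≤ G.toSubmodule := gen_le hx G.a_mem
  refine toSubmodule_injective (le_antisymm (fun y hy => ?_) hge)
  obtain ⟨_, hu, g, hg, rfl⟩ := Submodule.mem_sup.1 (gen_le_span_sup_gen_a_sub x S (hle hy))
  obtain ⟨R, rfl⟩ := Submodule.mem_span_singleton.1 hu
  have hR : R • x ∈ G.toSubmodule := by simpa using sub_mem hy (hge hg)
  simpa [hsmul R hR] using hg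

theorem gen_le_map_gen (f : E →ₗ[ℂ⟦X⟧] F) (hf : ∀ x, f (a x) = a (f x)) (x : E) :
    (gen (f x)).toSubmodule ≤ (gen x).toSubmodule.map f := by
  refine gen_le ⟨x, mem_gen x, rfl⟩ ?_
  rintro _ ⟨y, hy, rfl⟩
  exact ⟨a y, (gen x).a_mem y hy, hf y⟩

theorem gen_eq_top_of_range_le {f : E →ₗ[ℂ⟦X⟧] F} (hf : ∀ x, f (a x) = a (f x))
    (hinj : Function.Injective f) {x : E} (hx : LinearMap.range f ≤ (gen (f x)).toSubmodule) :
    (gen x).toSubmodule = ⊤ := by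
  refine eq_top_iff.2 fun y _ => ?_
  obtain ⟨z, hz, hzy⟩ := gen_le_map_gen f hf x (hx ⟨y, rfl⟩)
  exact hinj hzy ▸ hz

theorem gen_mk_self_eq_top (x : E) :
    (gen (⟨x, mem_gen x⟩ : (gen x).toSubmodule)).toSubmodule = ⊤ :=
  gen_eq_top_of_range_le (f := (gen x).toSubmodule.subtype) (fun _ => rfl) Subtype.val_injective
    (by simp)

end ABSub

end Gen

section RankOneHom

variable {E : Type*} [AddCommGroup E] [Module ℂ E] [Module ℂ⟦X⟧ E] [IsScalarTower ℂ ℂ⟦X⟧ E]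
  [ABAction E]

/-- `p` is a morphism to `E_μ`. The target is written `ℂ⟦X⟧` rather than `RankOne μ`, so that
morphisms with different numbers can be compared and multiplied by power series. -/
def IsRankOneHom (μ : ℂ) (p : E →ₗ[ℂ⟦X⟧] ℂ⟦X⟧) : Prop :=
  ∀ x, p (a x) = RankOne.aFun μ (p x)

namespace IsRankOneHom

variable {μ : ℂ} {p q : E →ₗ[ℂ⟦X⟧] ℂ⟦X⟧}

theorem sub (hp : IsRankOneHom μ p) (hq : IsRankOneHom μ q) : IsRankOneHom μ (p - q) :=
  fun x => by simp [hp x, hq x]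

theorem const_smul (hp : IsRankOneHom μ p) (c : ℂ) : IsRankOneHom μ (c • p) :=
  fun x => by simp [hp x]

theorem X_pow_smul (hp : IsRankOneHom μ p) (n : ℕ) :
    IsRankOneHom (μ - n) ((X ^ n : ℂ⟦X⟧) • p) :=
  fun x => by simp [hp x, RankOne.aFun_X_pow_mul]

theorem apply_a_sub (hp : IsRankOneHom μ p) (S : ℂ⟦X⟧) (x : E) :
    p (a x - S • x) = RankOne.aFun μ (p x) - S * p x := by
  rw [map_sub, hp, map_smul, smul_eq_mul]

theorem dvd_of_mem_gen (hp : IsRankOneHom μ p) {x y : E} {n : ℕ} (hx : X ^ n ∣ p x)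
    (hy : y ∈ (ABSub.gen x).toSubmodule) : X ^ n ∣ p y := by
  have gen_le : (ABSub.gen x).toSubmodule ≤ Submodule.comap p (Ideal.span {X ^ n}) := by
    refine ABSub.gen_le (by simpa [Ideal.mem_span_singleton] using hx) fun z hz => ?_
    rw [Submodule.mem_comap, Ideal.mem_span_singleton] at hz ⊢
    obtain ⟨R, hR⟩ := hz
    rw [hp, hR, RankOne.aFun_X_pow_mul]
    exact dvd_mul_right _ _
  simpa [Ideal.mem_span_singleton] using gen_le hy

theorem eq_zero_of_mem_gen (hp : IsRankOneHom μ p) {x y : E} (hx : p x = 0)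
    (hy : y ∈ (ABSub.gen x).toSubmodule) : p y = 0 :=
  ABSub.gen_le (G := LinearMap.ker p) hx
    (fun z (hz : p z = 0) => LinearMap.mem_ker.2 (by rw [hp, hz, map_zero])) hy

theorem exists_eq_X_pow_smul (hp : IsRankOneHom μ p) {φ : E}
    (hφ : (ABSub.gen φ).toSubmodule = ⊤) {n : ℕ} (hdvd : X ^ n ∣ p φ) :
    ∃ q : E →ₗ[ℂ⟦X⟧] ℂ⟦X⟧, IsRankOneHom (μ + n) q ∧ p = (X ^ n : ℂ⟦X⟧) • q := by
  have X_pow_ne_zero : (X ^ n : ℂ⟦X⟧) ≠ 0 := pow_ne_zero n X_ne_zero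
  have mulLeft_injective : Function.Injective (LinearMap.mulLeft ℂ⟦X⟧ (X ^ n : ℂ⟦X⟧)) :=
    mul_right_injective₀ X_pow_ne_zero
  have dvd_apply : ∀ x, X ^ n ∣ p x := fun x => hp.dvd_of_mem_gen hdvd (hφ ▸ Submodule.mem_top)
  let q := p.codRestrictOfInjective (LinearMap.mulLeft ℂ⟦X⟧ (X ^ n)) mulLeft_injective
    fun x => (dvd_apply x).imp fun _ h => h.symm
  have hq : ∀ x, X ^ n * q x = p x :=
    p.codRestrictOfInjective_comp_apply _ mulLeft_injective _
  refine ⟨q, fun x => mul_left_cancel₀ X_pow_ne_zero ?_, LinearMap.ext fun x => (hq x).symm⟩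
  rw [hq, hp, ← hq, RankOne.aFun_X_pow_mul]

theorem exists_eq_X_pow_smul_of_order (hp : IsRankOneHom μ p) {φ : E}
    (hφ : (ABSub.gen φ).toSubmodule = ⊤) {n : ℕ} (hn : (p φ).order = n) :
    ∃ q : E →ₗ[ℂ⟦X⟧] ℂ⟦X⟧,
      IsRankOneHom (μ + n) q ∧ p = (X ^ n : ℂ⟦X⟧) • q ∧ constantCoeff (q φ) ≠ 0 := by
  obtain ⟨U, hU, hpφ⟩ := order_eq_natCast_iff.1 hn
  obtain ⟨q, hq, rfl⟩ := hp.exists_eq_X_pow_smul hφ ⟨U, hpφ⟩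
  refine ⟨q, hq, rfl, ?_⟩
  rwa [mul_left_cancel₀ (pow_ne_zero n X_ne_zero) hpφ]

theorem exists_eq_smul_add_X_smul (hp : IsRankOneHom μ p) (hq : IsRankOneHom μ q) {φ : E}
    (hφ : (ABSub.gen φ).toSubmodule = ⊤) (hpφ : constantCoeff (p φ) ≠ 0) :
    ∃ (c : ℂ) (q' : E →ₗ[ℂ⟦X⟧] ℂ⟦X⟧),
      IsRankOneHom (μ + 1) q' ∧ q = c • p + (X : ℂ⟦X⟧) • q' := by
  let c := constantCoeff (q φ) / constantCoeff (p φ)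
  have hdvd : X ^ 1 ∣ (q - c • p) φ := by
    rw [pow_one, X_dvd_iff]
    simp [c, div_mul_cancel₀ _ hpφ, smul_eq_C_mul]
  obtain ⟨q', hq', h⟩ := (hq.sub (hp.const_smul c)).exists_eq_X_pow_smul hφ hdvd
  exact ⟨c, q', by simpa using hq', by rw [← pow_one X, ← h, add_sub_cancel]⟩

end IsRankOneHom

section CommonKer

variable {ι : Type*} {ρ : ι → ℂ} {p : ι → E →ₗ[ℂ⟦X⟧] ℂ⟦X⟧}

/-- The intersection of the kernels of the morphisms `p i`, `i ∈ I`, as an `a`-stable submodule. -/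
def commonKer (hp : ∀ i, IsRankOneHom (ρ i) (p i)) (I : Set ι) : ABSub E where
  toSubmodule := ⨅ i ∈ I, LinearMap.ker (p i)
  a_mem x hx := by
    change x ∈ ⨅ i ∈ I, LinearMap.ker (p i) at hx
    change a x ∈ ⨅ i ∈ I, LinearMap.ker (p i)
    simp only [Submodule.mem_iInf, LinearMap.mem_ker] at hx ⊢
    exact fun i hi => by rw [hp, hx i hi, map_zero]

theorem mem_commonKer {hp : ∀ i, IsRankOneHom (ρ i) (p i)} {I : Set ι} {x : E} :
    x ∈ (commonKer hp I).toSubmodule ↔ ∀ i ∈ I, p i x = 0 := by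
  simp [commonKer, Submodule.mem_iInf]

theorem commonKer_isNormal (hp : ∀ i, IsRankOneHom (ρ i) (p i)) (I : Set ι) :
    (commonKer hp I).IsNormal := by
  refine fun x => ⟨?_, ?_⟩
  · rintro ⟨hx, y, rfl⟩
    exact ⟨y, mem_commonKer.2 fun i hi => by simpa [X_ne_zero] using mem_commonKer.1 hx i hi, rfl⟩
  · rintro ⟨z, hz, rfl⟩
    exact ⟨Submodule.smul_mem _ _ hz, z, rfl⟩

end CommonKer

section Quot

variable {G H : ABSub E} {ν : ℂ}

/-- `π` is a surjective morphism `H → E_ν` with kernel `G`. -/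
structure IsRankOneQuot (H G : ABSub E) (ν : ℂ) (π : H.toSubmodule →ₗ[ℂ⟦X⟧] ℂ⟦X⟧) : Prop where
  hom : IsRankOneHom ν π
  surjective : Function.Surjective π
  apply_eq_zero_iff : ∀ x, π x = 0 ↔ (x : E) ∈ G.toSubmodule

theorem nonempty_abIso_quot_iff :
    Nonempty (ABIso (H.Quot G) (RankOne ν)) ↔ ∃ π, IsRankOneQuot H G ν π := by
  refine ⟨fun ⟨e⟩ => ?_, fun ⟨π, hπ⟩ => ?_⟩
  · let e' : H.Quot G ≃ₗ[ℂ⟦X⟧] ℂ⟦X⟧ := e.toLinearEquiv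
    refine ⟨e'.toLinearMap ∘ₗ (G.inside H).toSubmodule.mkQ,
      fun x => e.map_a ((G.inside H).toSubmodule.mkQ x),
      e'.surjective.comp (Submodule.mkQ_surjective _), fun x => ?_⟩
    exact (e'.map_eq_zero_iff).trans (Submodule.Quotient.mk_eq_zero _)
  · have ker_eq : (G.inside H).toSubmodule = LinearMap.ker π :=
      Submodule.ext fun x => (hπ.apply_eq_zero_iff x).symm
    let e : H.Quot G ≃ₗ[ℂ⟦X⟧] ℂ⟦X⟧ :=
      Submodule.quotEquivOfEq _ _ ker_eq ≪≫ₗ π.quotKerEquivOfSurjective hπ.surjective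
    refine ⟨⟨e, fun x => ?_⟩⟩
    obtain ⟨y, rfl⟩ := (G.inside H).toSubmodule.mkQ_surjective x
    exact hπ.hom y

theorem finrank_quot_eq_one_of_abIso (e : ABIso (H.Quot G) (RankOne ν)) :
    Module.finrank ℂ⟦X⟧ (H.Quot G) = 1 :=
  (e.toLinearEquiv.finrank_eq).trans (Module.finrank_self ℂ⟦X⟧)

end Quot

end RankOneHom

section HomFamily

variable {E : Type*} [AddCommGroup E] [Module ℂ E] [Module ℂ⟦X⟧ E] [IsScalarTower ℂ ℂ⟦X⟧ E]
  [ABAction E] {p : ℂ → E →ₗ[ℂ⟦X⟧] ℂ⟦X⟧} {Λ Λ' : Finset ℂ} {d : ℕ} {ψ : E}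

/-- A family of morphisms `p ρ` to `E_ρ`, `ρ ∈ Λ`, which all map `ψ` to a series of order `d`.
The family is indexed by the numbers themselves, hence these are pairwise distinct. -/
structure IsHomFamily (p : ℂ → E →ₗ[ℂ⟦X⟧] ℂ⟦X⟧) (Λ : Finset ℂ) (d : ℕ) (ψ : E) : Prop where
  hom : ∀ ρ ∈ Λ, IsRankOneHom ρ (p ρ)
  order_apply : ∀ ρ ∈ Λ, (p ρ ψ).order = d

/-- A family of morphisms which embeds the submodule generated by `ψ` in a sum of modules `E_ρ`. -/
structure IsEmbeddingFamily (p : ℂ → E →ₗ[ℂ⟦X⟧] ℂ⟦X⟧) (Λ : Finset ℂ) (d : ℕ) (ψ : E) : Prop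
    extends IsHomFamily p Λ d ψ where
  eq_zero : ∀ x ∈ (ABSub.gen ψ).toSubmodule, (∀ ρ ∈ Λ, p ρ x = 0) → x = 0

theorem IsRankOneQuot.constantCoeff_apply_ne_zero {G : ABSub E} {ν : ℂ}
    {π : (ABSub.gen ψ).toSubmodule →ₗ[ℂ⟦X⟧] ℂ⟦X⟧} (hπ : IsRankOneQuot (ABSub.gen ψ) G ν π) :
    constantCoeff (π ⟨ψ, ABSub.mem_gen ψ⟩) ≠ 0 := by
  intro h
  obtain ⟨y, hy⟩ := hπ.surjective 1
  have X_dvd : X ^ 1 ∣ π y := hπ.hom.dvd_of_mem_gen (by rwa [pow_one, X_dvd_iff])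
    (ABSub.gen_mk_self_eq_top ψ ▸ Submodule.mem_top)
  simp [hy, X_dvd_iff] at X_dvd

theorem IsRankOneHom.exists_isRankOneQuot {ρ : ℂ} {q : E →ₗ[ℂ⟦X⟧] ℂ⟦X⟧} (hq : IsRankOneHom ρ q)
    (hψ : (q ψ).order = d) {G : ABSub E}
    (hG : ∀ x ∈ (ABSub.gen ψ).toSubmodule, q x = 0 ↔ x ∈ G.toSubmodule) :
    ∃ π, IsRankOneQuot (ABSub.gen ψ) G (ρ + d) π := by
  have hq' : IsRankOneHom ρ (q ∘ₗ (ABSub.gen ψ).toSubmodule.subtype) := fun x => hq x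
  obtain ⟨π, hπ, hqπ, hunit⟩ :=
    hq'.exists_eq_X_pow_smul_of_order (ABSub.gen_mk_self_eq_top ψ) hψ
  refine ⟨π, hπ, fun S => ?_, fun x => ?_⟩
  · refine ⟨(S * (π ⟨ψ, ABSub.mem_gen ψ⟩)⁻¹) • ⟨ψ, ABSub.mem_gen ψ⟩, ?_⟩
    rw [map_smul, smul_eq_mul, mul_assoc, PowerSeries.inv_mul_cancel _ hunit, mul_one]
  · have hx : q x = X ^ d * π x := LinearMap.congr_fun hqπ x
    rw [← hG x x.2, hx, mul_eq_zero_iff_left (pow_ne_zero d X_ne_zero)]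

variable {G : ABSub E} {ρ : ℂ} {π : (ABSub.gen ψ).toSubmodule →ₗ[ℂ⟦X⟧] ℂ⟦X⟧}

namespace IsHomFamily

theorem mono (h : IsHomFamily p Λ d ψ) (hle : Λ' ⊆ Λ) : IsHomFamily p Λ' d ψ :=
  ⟨fun σ hσ => h.hom σ (hle hσ), fun σ hσ => h.order_apply σ (hle hσ)⟩

theorem a_sub (h : IsHomFamily p Λ d ψ) {σ : ℂ} (hσ : σ ∉ Λ) {T : ℂ⟦X⟧}
    (hT : constantCoeff T = σ + d) : IsHomFamily p Λ (d + 1) (a ψ - (X * T) • ψ) where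
  hom := h.hom
  order_apply ρ hρ := by
    rw [(h.hom ρ hρ).apply_a_sub]
    refine RankOne.order_aFun_sub (h.order_apply ρ hρ) fun hρT => hσ ?_
    rwa [← add_right_cancel (hρT.symm.trans hT)]

theorem exists_apply_ne_zero (h : IsHomFamily p Λ d ψ) {q : E →ₗ[ℂ⟦X⟧] ℂ⟦X⟧}
    (hq : IsRankOneHom ρ q) (hψ : (q ψ).order = d) :
    ∃ x ∈ (ABSub.gen ψ).toSubmodule, q x ≠ 0 ∧ ∀ σ ∈ Λ, σ ≠ ρ → p σ x = 0 := by
  induction Λ using Finset.induction_on generalizing ψ d with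
  | empty => exact ⟨ψ, ABSub.mem_gen ψ, ne_zero_of_order_eq_natCast hψ, by simp⟩
  | insert σ Λ hσ ih =>
    have hΛ : IsHomFamily p Λ d ψ := h.mono (Finset.subset_insert σ Λ)
    by_cases hσρ : σ = ρ
    · obtain ⟨x, hx, hqx, hpx⟩ := ih hΛ hψ
      exact ⟨x, hx, hqx, by simpa [hσρ] using hpx⟩
    -- `a - X T` kills `p σ ψ` and raises the order of `q ψ` and of the other `p τ ψ` by one.
    have hpσ := h.hom σ (Finset.mem_insert_self σ Λ)
    obtain ⟨T, hT, hpσψ⟩ :=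
      RankOne.exists_aFun_eq_mul_self σ (h.order_apply σ (Finset.mem_insert_self σ Λ))
    have hqψ : (q (a ψ - (X * T) • ψ)).order = ((d + 1 : ℕ) : ℕ∞) := by
      rw [hq.apply_a_sub]
      exact RankOne.order_aFun_sub hψ fun hρT => hσρ (add_right_cancel (hT.symm.trans hρT))
    obtain ⟨x, hx, hqx, hpx⟩ := ih (hΛ.a_sub hσ hT) hqψ
    have hpσx : p σ x = 0 :=
      hpσ.eq_zero_of_mem_gen (by rw [hpσ.apply_a_sub, hpσψ, sub_self]) hx
    refine ⟨x, ABSub.gen_le ?_ (ABSub.gen ψ).a_mem hx, hqx, ?_⟩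
    · exact (ABSub.gen ψ).a_sub_smul_mem _ (ABSub.mem_gen ψ)
    · rintro τ hτ hτρ
      rcases Finset.mem_insert.1 hτ with rfl | hτ
      exacts [hpσx, hpx τ hτ hτρ]

theorem exists_quot_apply_ne_zero (h : IsHomFamily p Λ d ψ)
    (hπ : IsRankOneQuot (ABSub.gen ψ) G (ρ + d) π) :
    ∃ x, π x ≠ 0 ∧ ∀ σ ∈ Λ, σ ≠ ρ → p σ (x : E) = 0 := by
  have restrict : IsHomFamily (fun ρ => p ρ ∘ₗ (ABSub.gen ψ).toSubmodule.subtype) Λ d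
      ⟨ψ, ABSub.mem_gen ψ⟩ := ⟨fun ρ hρ x => h.hom ρ hρ x, h.order_apply⟩
  have hXπ : IsRankOneHom ρ ((X ^ d : ℂ⟦X⟧) • π) := by simpa using hπ.hom.X_pow_smul d
  obtain ⟨x, -, hπx, hpx⟩ := restrict.exists_apply_ne_zero hXπ
    (order_eq_natCast_iff.2 ⟨_, hπ.constantCoeff_apply_ne_zero, rfl⟩)
  exact ⟨x, right_ne_zero_of_mul hπx, hpx⟩

end IsHomFamily

namespace IsEmbeddingFamily

theorem mem_of_isRankOneQuot (h : IsEmbeddingFamily p Λ d ψ)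
    (hπ : IsRankOneQuot (ABSub.gen ψ) G (ρ + d) π) : ρ ∈ Λ := by
  obtain ⟨x, hπx, hpx⟩ := h.exists_quot_apply_ne_zero hπ
  by_contra hρ
  have hx : x = 0 :=
    Subtype.ext (h.eq_zero x x.2 fun σ hσ => hpx σ hσ (ne_of_mem_of_not_mem hσ hρ))
  exact hπx (hx ▸ map_zero π)

theorem eq_zero_of_quot_apply_eq_zero (h : IsEmbeddingFamily p Λ d ψ)
    (hπ : IsRankOneQuot (ABSub.gen ψ) G (ρ + d) π) {x : (ABSub.gen ψ).toSubmodule} (hx : π x = 0)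
    (hpx : ∀ σ ∈ Λ.erase ρ, p σ (x : E) = 0) : x = 0 := by
  obtain ⟨y, hπy, hpy⟩ := h.exists_quot_apply_ne_zero hπ
  let z := p ρ x • y - p ρ y • x
  have hz : z = 0 := by
    refine Subtype.ext (h.eq_zero z z.2 fun σ hσ => ?_)
    change p σ (p ρ x • (y : E) - p ρ y • (x : E)) = 0
    rw [map_sub, map_smul, map_smul, smul_eq_mul, smul_eq_mul]
    rcases eq_or_ne σ ρ with rfl | hσρ
    · ring
    · rw [hpy σ hσ hσρ, hpx σ (Finset.mem_erase.2 ⟨hσρ, hσ⟩), mul_zero, mul_zero, sub_zero]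
  have hpρx : p ρ x = 0 := by
    have hπz : π z = 0 := hz ▸ map_zero π
    simpa [z, hx, hπy] using hπz
  refine Subtype.ext (h.eq_zero x x.2 fun σ hσ => ?_)
  rcases eq_or_ne σ ρ with rfl | hσρ
  exacts [hpρx, hpx σ (Finset.mem_erase.2 ⟨hσρ, hσ⟩)]

theorem exists_erase (h : IsEmbeddingFamily p Λ d ψ) (hπ : IsRankOneQuot (ABSub.gen ψ) G (ρ + d) π)
    (hG : G.toSubmodule ≤ (ABSub.gen ψ).toSubmodule) :
    ∃ ψ', G = ABSub.gen ψ' ∧ IsEmbeddingFamily p (Λ.erase ρ) (d + 1) ψ' := by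
  have hπψ : (π ⟨ψ, ABSub.mem_gen ψ⟩).order = (0 : ℕ) := by
    simpa [order_eq_zero_iff] using hπ.constantCoeff_apply_ne_zero
  obtain ⟨T, hT, hπT⟩ := RankOne.exists_aFun_eq_mul_self _ hπψ
  have mem_G {x : (ABSub.gen ψ).toSubmodule} (hx : π x = 0) : (x : E) ∈ G.toSubmodule :=
    (hπ.apply_eq_zero_iff x).1 hx
  have hG_eq : G = ABSub.gen (a ψ - (X * T) • ψ) := by
    refine ABSub.eq_gen_a_sub hG ?_ fun R hR => ?_
    · refine mem_G (x := a ⟨ψ, ABSub.mem_gen ψ⟩ - (X * T) • ⟨ψ, ABSub.mem_gen ψ⟩) ?_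
      rw [hπ.hom.apply_a_sub, hπT, sub_self]
    · have hπR : π (R • ⟨ψ, ABSub.mem_gen ψ⟩) = 0 := (hπ.apply_eq_zero_iff _).2 hR
      rw [map_smul, smul_eq_mul] at hπR
      exact (mul_eq_zero.1 hπR).resolve_right (ne_zero_of_order_eq_natCast hπψ)
  refine ⟨_, hG_eq, (h.mono (Finset.erase_subset _ _)).a_sub (Finset.notMem_erase _ _)
    (by simpa using hT), fun x hx hpx => ?_⟩
  rw [← hG_eq] at hx
  have hx0 := h.eq_zero_of_quot_apply_eq_zero (x := ⟨x, hG hx⟩) hπ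
    ((hπ.apply_eq_zero_iff _).2 hx) hpx
  exact congrArg Subtype.val hx0

end IsEmbeddingFamily

end HomFamily

section Embedding

theorem eq_zero_of_forall_exists_X_pow_smul {K M : Type*} [Field K] [AddCommGroup M]
    [Module K⟦X⟧ M] [Module.Finite K⟦X⟧ M] {x : M}
    (h : ∀ n : ℕ, ∃ y : M, (X ^ n : K⟦X⟧) • y = x) : x = 0 := by
  have span_X_ne_top : Ideal.span {(X : K⟦X⟧)} ≠ ⊤ :=
    Ideal.span_singleton_ne_top X_prime.not_isUnit
  rw [← Submodule.mem_bot K⟦X⟧, ← Ideal.iInf_pow_smul_eq_bot_of_isLocalRing _ span_X_ne_top,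
    Submodule.mem_iInf]
  intro n
  obtain ⟨y, rfl⟩ := h n
  exact Submodule.smul_mem_smul
    (Ideal.pow_mem_pow (Ideal.mem_span_singleton_self X) n) Submodule.mem_top

section Regular

variable {E : Type*} [AddCommGroup E] [Module ℂ E] [Module ℂ⟦X⟧ E] [IsScalarTower ℂ ℂ⟦X⟧ E]
  [ABAction E]

theorem HasSimplePole.exists_a_X_pow_smul (h : HasSimplePole E) (n : ℕ) (y : E) :
    ∃ z : E, a ((X ^ n : ℂ⟦X⟧) • y) = (X ^ (n + 1) : ℂ⟦X⟧) • z := by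
  obtain ⟨z, hz⟩ := h y
  have derivative_X_pow :
      X ^ 2 * PowerSeries.derivative ℂ (X ^ n : ℂ⟦X⟧) = X ^ (n + 1) * (n : ℂ⟦X⟧) := by
    cases n with
    | zero => simp
    | succ n =>
      rw [Derivation.leibniz_pow]
      simp only [Nat.add_sub_cancel, derivative_X, smul_eq_mul, mul_one, nsmul_eq_mul]
      ring
  exact ⟨z + (n : ℂ⟦X⟧) • y, by
    rw [ABAction.a_smul, hz, derivative_X_pow, smul_add, smul_smul, smul_smul, ← pow_succ]⟩

theorem HasSimplePole.constantCoeff_eq_zero_of_a_eq_smul [Module.Finite ℂ⟦X⟧ E]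
    (h : HasSimplePole E) {x : E} (hx : x ≠ 0) {S : ℂ⟦X⟧} (hS : a x = S • x) :
    constantCoeff S = 0 := by
  by_contra hunit
  refine hx (eq_zero_of_forall_exists_X_pow_smul (K := ℂ) fun n => ?_)
  induction n with
  | zero => exact ⟨x, by simp⟩
  | succ n ih =>
    obtain ⟨y, hy⟩ := ih
    obtain ⟨z, hz⟩ := h.exists_a_X_pow_smul n y
    refine ⟨S⁻¹ • z, ?_⟩
    rw [smul_comm, ← hz, hy, hS, smul_smul, PowerSeries.inv_mul_cancel S hunit, one_smul]

theorem IsRegular.constantCoeff_eq_zero_of_a_eq_smul (h : IsRegular E) {x : E} (hx : x ≠ 0)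
    {S : ℂ⟦X⟧} (hS : a x = S • x) : constantCoeff S = 0 := by
  obtain ⟨N, i, hi, hN⟩ := h
  refine hN.constantCoeff_eq_zero_of_a_eq_smul
    ((map_ne_zero_iff i.toLinearMap hi).2 hx) ?_
  rw [← map_smul, ← hS]
  exact (i.map_a x).symm

theorem IsRegular.exists_injective_isRankOneHom [Module.Free ℂ⟦X⟧ E] (h : IsRegular E)
    (h1 : Module.finrank ℂ⟦X⟧ E = 1) :
    ∃ (μ : ℂ) (p : E →ₗ[ℂ⟦X⟧] ℂ⟦X⟧), IsRankOneHom μ p ∧ Function.Injective p := by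
  have : Module.Finite ℂ⟦X⟧ E := Module.finite_of_finrank_eq_succ h1
  let e : E ≃ₗ[ℂ⟦X⟧] ℂ⟦X⟧ :=
    LinearEquiv.ofFinrankEq E ℂ⟦X⟧ (h1.trans (Module.finrank_self ℂ⟦X⟧).symm)
  let x₀ := e.symm 1
  have eq_smul : ∀ x : E, x = e x • x₀ := fun x => e.injective (by simp [x₀])
  have x₀_ne_zero : x₀ ≠ 0 := e.symm.map_ne_zero_iff.2 one_ne_zero
  obtain ⟨T, hT⟩ := X_dvd_iff.2 (h.constantCoeff_eq_zero_of_a_eq_smul x₀_ne_zero (eq_smul (a x₀)))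
  obtain ⟨V, hV, aFun_V⟩ := RankOne.exists_aFun_constantCoeff_eq T
  have e_a : ∀ x, e (a x) = e x * (X * T) + X ^ 2 * PowerSeries.derivative ℂ (e x) := fun x => by
    conv_lhs => rw [eq_smul x, ABAction.a_smul, map_add, map_smul, map_smul, hT]
    simp [x₀]
  refine ⟨constantCoeff T, V • e.toLinearMap, fun x => ?_, fun x y hxy => ?_⟩
  · change V * e (a x) = RankOne.aFun _ (V * e x)
    rw [e_a, mul_comm V (e x), RankOne.aFun_mul, aFun_V]
    ring
  · have V_ne_zero : V ≠ 0 := fun h0 => hV (h0 ▸ map_zero _)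
    exact e.injective (mul_left_cancel₀ V_ne_zero hxy)

end Regular

variable {E : Type*} [AddCommGroup E] [Module ℂ E] [Module ℂ⟦X⟧ E] [IsScalarTower ℂ ℂ⟦X⟧ E]
  [ABAction E] {p : ℂ → E →ₗ[ℂ⟦X⟧] ℂ⟦X⟧} {Λ : Finset ℂ} {φ : E}

theorem IsSemisimple.exists_isRankOneHom (h : IsSemisimple E) :
    ∃ (n : ℕ) (μ : Fin n → ℂ) (p : Fin n → E →ₗ[ℂ⟦X⟧] ℂ⟦X⟧),
      (∀ i, IsRankOneHom (μ i) (p i)) ∧ ∀ x, (∀ i, p i x = 0) → x = 0 := by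
  obtain ⟨n, M, hM, f, hf⟩ := h
  choose μ q hq q_injective using fun i => (hM i).1.exists_injective_isRankOneHom (hM i).2
  refine ⟨n, μ, fun i => q i ∘ₗ LinearMap.proj i ∘ₗ f.toLinearMap, fun i x => ?_, fun x hx => ?_⟩
  · exact (congrArg (fun y => q i (y i)) (f.map_a x)).trans (hq i _)
  · refine hf ((funext fun i => q_injective i ?_ : f.toLinearMap x = 0).trans (map_zero _).symm)
    exact (hx i).trans (map_zero (q i)).symm

instance (μ : ℂ) : Module.Free ℂ⟦X⟧ (RankOne μ) := inferInstanceAs (Module.Free ℂ⟦X⟧ ℂ⟦X⟧)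

instance (μ : ℂ) : Module.Finite ℂ⟦X⟧ (RankOne μ) := inferInstanceAs (Module.Finite ℂ⟦X⟧ ℂ⟦X⟧)

theorem rankOne_hasSimplePole (μ : ℂ) : HasSimplePole (RankOne μ) := by
  intro (S : ℂ⟦X⟧)
  change ∃ R : ℂ⟦X⟧, RankOne.aFun μ S = X * R
  refine ⟨X * PowerSeries.derivative ℂ S + C μ * S, ?_⟩
  rw [RankOne.aFun_apply]
  ring

theorem rankOne_isRegular (μ : ℂ) : IsRegular (RankOne μ) :=
  ⟨⟨RankOne μ⟩, ⟨LinearMap.id, fun _ => rfl⟩, Function.injective_id, rankOne_hasSimplePole μ⟩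

theorem isSemisimple_of_isRankOneHom {n : ℕ} {μ : Fin n → ℂ} {p : Fin n → E →ₗ[ℂ⟦X⟧] ℂ⟦X⟧}
    (hp : ∀ i, IsRankOneHom (μ i) (p i)) (hp0 : ∀ x, (∀ i, p i x = 0) → x = 0) :
    IsSemisimple E := by
  refine ⟨n, fun i => ⟨RankOne (μ i)⟩,
    fun i => ⟨rankOne_isRegular (μ i), Module.finrank_self ℂ⟦X⟧⟩,
    ⟨LinearMap.pi p, fun x => funext fun i => hp i x⟩, ?_⟩
  exact (injective_iff_map_eq_zero (LinearMap.pi p)).2 fun x hx => hp0 x fun i => congrFun hx i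

theorem IsHomFamily.insert {d : ℕ} (h : IsHomFamily p Λ d φ) {μ : ℂ} (hμ : μ ∉ Λ)
    {q : E →ₗ[ℂ⟦X⟧] ℂ⟦X⟧} (hq : IsRankOneHom μ q) (hφ : (q φ).order = d) :
    IsHomFamily (Function.update p μ q) (insert μ Λ) d φ := by
  constructor <;> intro ρ hρ <;> rcases Finset.mem_insert.1 hρ with rfl | hρ
  · simpa using hq
  · simpa [ne_of_mem_of_not_mem hρ hμ] using h.hom ρ hρ
  · simpa using hφ
  · simpa [ne_of_mem_of_not_mem hρ hμ] using h.order_apply ρ hρ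

theorem IsHomFamily.exists_refinement (hφ : (ABSub.gen φ).toSubmodule = ⊤)
    (h : IsHomFamily p Λ 0 φ) {μ : ℂ} {q : E →ₗ[ℂ⟦X⟧] ℂ⟦X⟧} (hq : IsRankOneHom μ q) :
    ∃ (p' : ℂ → E →ₗ[ℂ⟦X⟧] ℂ⟦X⟧) (Λ' : Finset ℂ), IsHomFamily p' Λ' 0 φ ∧
      ∀ x, (∀ ρ ∈ Λ', p' ρ x = 0) → (∀ ρ ∈ Λ, p ρ x = 0) ∧ q x = 0 := by
  -- If `Λ` already contains the number `μ + n` of the generating morphism divided out of `q`, a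
  -- combination with that member of the family replaces `μ` by `μ + n + 1`.
  induction hm : (Λ.filter fun ρ => μ.re ≤ ρ.re).card using Nat.strong_induction_on
    generalizing μ q with | _ m ih
  subst hm
  by_cases hqφ : q φ = 0
  · exact ⟨p, Λ, h, fun x hx => ⟨hx, hq.eq_zero_of_mem_gen hqφ (hφ ▸ Submodule.mem_top)⟩⟩
  obtain ⟨n, hn⟩ := exists_order_eq_natCast hqφ
  obtain ⟨r, hr, rfl, hrφ⟩ := hq.exists_eq_X_pow_smul_of_order hφ hn
  by_cases hmem : μ + n ∈ Λ
  · have hpφ := order_eq_zero_iff.1 (by simpa using h.order_apply _ hmem)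
    obtain ⟨c, s, hs, rfl⟩ := (h.hom _ hmem).exists_eq_smul_add_X_smul hr hφ hpφ
    have card_lt : (Λ.filter fun ρ => (μ + n + 1).re ≤ ρ.re).card <
        (Λ.filter fun ρ => μ.re ≤ ρ.re).card := by
      refine Finset.card_lt_card (Finset.ssubset_iff_of_subset ?_ |>.2 ⟨μ + n, ?_, ?_⟩)
      · refine Finset.monotone_filter_right Λ fun ρ _ hρ => le_trans ?_ hρ
        simp [add_assoc, add_nonneg]
      · simp [hmem]
      · simp
    obtain ⟨p', Λ', h', hp'⟩ := ih _ card_lt hs rfl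
    exact ⟨p', Λ', h', fun x hx => ⟨(hp' x hx).1, by simp [(hp' x hx).1 _ hmem, (hp' x hx).2]⟩⟩
  · refine ⟨_, _, h.insert hmem hr (by simpa [order_eq_zero_iff] using hrφ), fun x hx => ?_⟩
    refine ⟨fun ρ hρ => ?_, ?_⟩
    · simpa [ne_of_mem_of_not_mem hρ hmem] using hx ρ (Finset.mem_insert_of_mem hρ)
    · have hrx : r x = 0 := by simpa using hx _ (Finset.mem_insert_self _ Λ)
      simp [hrx]

theorem IsSemisimple.exists_isEmbeddingFamily (hφ : (ABSub.gen φ).toSubmodule = ⊤)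
    (h : IsSemisimple E) :
    ∃ (p : ℂ → E →ₗ[ℂ⟦X⟧] ℂ⟦X⟧) (Λ : Finset ℂ), IsEmbeddingFamily p Λ 0 φ := by
  obtain ⟨n, μ, q, hq, hq0⟩ := h.exists_isRankOneHom
  have exists_family : ∀ s : Finset (Fin n), ∃ (p : ℂ → E →ₗ[ℂ⟦X⟧] ℂ⟦X⟧) (Λ : Finset ℂ),
      IsHomFamily p Λ 0 φ ∧ ∀ x, (∀ ρ ∈ Λ, p ρ x = 0) → ∀ i ∈ s, q i x = 0 := by
    intro s
    induction s using Finset.induction_on with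
    | empty => exact ⟨0, ∅, ⟨by simp, by simp⟩, by simp⟩
    | insert i s _ ih =>
      obtain ⟨p, Λ, h, hp⟩ := ih
      obtain ⟨p', Λ', h', hp'⟩ := h.exists_refinement hφ (hq i)
      exact ⟨p', Λ', h', fun x hx => Finset.forall_mem_insert _ _ _ |>.2
        ⟨(hp' x hx).2, hp x (hp' x hx).1⟩⟩
  obtain ⟨p, Λ, h, hp⟩ := exists_family Finset.univ
  exact ⟨p, Λ, h, fun x _ hx => hq0 x fun i => hp x hx i (Finset.mem_univ i)⟩

end Embedding

section JordanHolder

variable {E : Type*} [AddCommGroup E] [Module ℂ E] [Module ℂ⟦X⟧ E] [IsScalarTower ℂ ℂ⟦X⟧ E]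
  [ABAction E] {p : ℂ → E →ₗ[ℂ⟦X⟧] ℂ⟦X⟧} {Λ : Finset ℂ} {φ : E} {k : ℕ}

theorem isJordanHolderWith_iff {F : Fin (k + 1) → ABSub E} {ν : Fin k → ℂ} :
    IsJordanHolderWith F ν ↔ (F 0).toSubmodule = ⊥ ∧ (F (Fin.last k)).toSubmodule = ⊤ ∧
      (∀ j : Fin k, (F j.castSucc).toSubmodule ≤ (F j.succ).toSubmodule) ∧ (∀ j, (F j).IsNormal) ∧
      ∀ j : Fin k, ∃ π, IsRankOneQuot (F j.succ) (F j.castSucc) (ν j) π := by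
  simp only [← nonempty_abIso_quot_iff]
  exact ⟨fun ⟨⟨h0, h1, hle, hnormal, _⟩, hν⟩ => ⟨h0, h1, hle, hnormal, hν⟩,
    fun ⟨h0, h1, hle, hnormal, hν⟩ => ⟨⟨h0, h1, hle, hnormal, fun j =>
      finrank_quot_eq_one_of_abIso (hν j).some⟩, hν⟩⟩

theorem setOf_castSucc_le_castSucc (j : Fin k) :
    {l : Fin k | j.castSucc ≤ l.castSucc} = insert j {l : Fin k | j.succ ≤ l.castSucc} := by
  ext l
  simp only [Set.mem_ofPred_eq, Set.mem_insert_iff, Fin.le_def, Fin.ext_iff, Fin.val_castSucc,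
    Fin.val_succ]
  omega

section KerFlag

variable {ρ : Fin k → ℂ} {q : Fin k → E →ₗ[ℂ⟦X⟧] ℂ⟦X⟧}

/-- The increasing sequence of submodules whose `j`-th term, `j ∈ [0, k]`, is the intersection of
the kernels of the morphisms `q_{j+1}, …, q_k`. -/
def kerFlag (hq : ∀ j, IsRankOneHom (ρ j) (q j)) (j : Fin (k + 1)) : ABSub E :=
  commonKer hq {l | j ≤ l.castSucc}

theorem kerFlag_last (hq : ∀ j, IsRankOneHom (ρ j) (q j)) :
    (kerFlag hq (Fin.last k)).toSubmodule = ⊤ :=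
  Submodule.eq_top_iff'.2 fun _ => mem_commonKer.2 fun l hl =>
    absurd hl (Fin.castSucc_lt_last l).not_ge

theorem mem_kerFlag_castSucc (hq : ∀ j, IsRankOneHom (ρ j) (q j)) {j : Fin k} {x : E} :
    x ∈ (kerFlag hq j.castSucc).toSubmodule ↔ q j x = 0 ∧ x ∈ (kerFlag hq j.succ).toSubmodule := by
  simp only [kerFlag, mem_commonKer, setOf_castSucc_le_castSucc, Set.forall_mem_insert]

theorem kerFlag_castSucc_le_succ (hq : ∀ j, IsRankOneHom (ρ j) (q j)) (j : Fin k) :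
    (kerFlag hq j.castSucc).toSubmodule ≤ (kerFlag hq j.succ).toSubmodule :=
  fun _ hx => ((mem_kerFlag_castSucc hq).1 hx).2

theorem exists_isRankOneQuot_kerFlag (hq : ∀ j, IsRankOneHom (ρ j) (q j)) {j : Fin k} {ψ : E}
    (hψ : kerFlag hq j.succ = ABSub.gen ψ) {d : ℕ} (hd : (q j ψ).order = d) :
    ∃ π, IsRankOneQuot (ABSub.gen ψ) (kerFlag hq j.castSucc) (ρ j + d) π :=
  (hq j).exists_isRankOneQuot hd fun x hx => by simp [mem_kerFlag_castSucc, hψ, hx]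

end KerFlag

/-- The sequence `ν_j + j`, `j ∈ [1, k]`, shifted by `-k`: for a Jordan–Hölder sequence of a
semi-simple module generated by `φ`, it lists the numbers `ρ` of the morphisms to `E_ρ` which map
`φ` to a generator. -/
def twisted (ν : Fin k → ℂ) (j : Fin k) : ℂ := ν j + ((j : ℕ) + 1) - k

theorem twisted_add_natCast (ν : Fin k → ℂ) {j : Fin k} {d : ℕ} (hd : d + j.succ = k) :
    twisted ν j + d = ν j := by
  have hk : (k : ℂ) = d + (j + 1) := by simpa using congrArg (Nat.cast : ℕ → ℂ) hd.symm
  rw [twisted, hk]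
  ring

namespace IsEmbeddingFamily

theorem bijOn_twisted (h : IsEmbeddingFamily p Λ 0 φ) (hφ : (ABSub.gen φ).toSubmodule = ⊤)
    {F : Fin (k + 1) → ABSub E} {ν : Fin k → ℂ} (hF : IsJordanHolderWith F ν) :
    Set.BijOn (twisted ν) Set.univ Λ := by
  obtain ⟨h0, h1, hle, -, hν⟩ := isJordanHolderWith_iff.1 hF
  have exists_gen : ∀ j : Fin (k + 1), ∃ (ψ : E) (Λ' : Finset ℂ) (d : ℕ), d + j = k ∧
      F j = ABSub.gen ψ ∧ IsEmbeddingFamily p Λ' d ψ ∧ Λ' ⊆ Λ ∧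
      Set.BijOn (twisted ν) {l | j ≤ l.castSucc} (Λ \ Λ') := by
    refine Fin.reverseInduction ⟨φ, Λ, 0, by simp, ?_, h, subset_rfl, ?_⟩ ?_
    · exact ABSub.toSubmodule_injective (h1.trans hφ.symm)
    · simp [Fin.last_le_iff, Fin.castSucc_ne_last]
    · rintro j ⟨ψ, Λ', d, hd, hFψ, hψ, hΛ', hbij⟩
      obtain ⟨π, hπ⟩ := hFψ ▸ twisted_add_natCast ν hd ▸ hν j
      have hmem : twisted ν j ∈ Λ' := hψ.mem_of_isRankOneQuot hπ
      obtain ⟨ψ', hFψ', hψ'⟩ := hψ.exists_erase hπ (hFψ ▸ hle j)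
      refine ⟨ψ', _, d + 1, ?_, hFψ', hψ', (Finset.erase_subset _ _).trans hΛ', ?_⟩
      · rw [Fin.val_succ] at hd
        rw [Fin.val_castSucc]
        omega
      · rw [setOf_castSucc_le_castSucc, Finset.coe_erase, Set.sdiff_sdiff_eq_sdiff_union
          (Set.singleton_subset_iff.2 (hΛ' hmem)), Set.union_singleton]
        exact hbij.insert fun hj => hj.2 hmem
  obtain ⟨ψ, Λ', d, -, hFψ, hψ, -, hbij⟩ := exists_gen 0
  have hψ0 : ψ = 0 := (Submodule.mem_bot ℂ⟦X⟧).1 (h0 ▸ hFψ ▸ ABSub.mem_gen ψ)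
  have hΛ' : Λ' = ∅ := Finset.eq_empty_of_forall_notMem fun ρ hρ =>
    ne_zero_of_order_eq_natCast (hψ.order_apply ρ hρ) (hψ0 ▸ map_zero (p ρ))
  simpa [hΛ', Set.ofPred_true] using hbij

theorem exists_kerFlag_eq_gen (h : IsEmbeddingFamily p Λ 0 φ)
    (hφ : (ABSub.gen φ).toSubmodule = ⊤) {ρ : Fin k → ℂ} (hρ : Set.BijOn ρ Set.univ Λ)
    (hp : ∀ j, IsRankOneHom (ρ j) (p (ρ j))) (j : Fin (k + 1)) :
    ∃ (ψ : E) (Λ' : Finset ℂ) (d : ℕ), d + j = k ∧ kerFlag hp j = ABSub.gen ψ ∧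
      IsEmbeddingFamily p Λ' d ψ ∧ Set.BijOn ρ {l | j ≤ l.castSucc}ᶜ Λ' := by
  induction j using Fin.reverseInduction with
  | last =>
    refine ⟨φ, Λ, 0, by simp, ABSub.toSubmodule_injective ((kerFlag_last hp).trans hφ.symm), h, ?_⟩
    simpa [Fin.last_le_iff, Fin.castSucc_ne_last] using hρ
  | cast j ih =>
    obtain ⟨ψ, Λ', d, hd, hψ, h', hbij⟩ := ih
    have hj : j ∈ {l : Fin k | j.succ ≤ l.castSucc}ᶜ := by simp [Fin.le_def]
    obtain ⟨π, hπ⟩ := exists_isRankOneQuot_kerFlag hp hψ (h'.order_apply _ (hbij.mapsTo hj))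
    obtain ⟨ψ', hψ', h''⟩ := h'.exists_erase hπ (hψ ▸ kerFlag_castSucc_le_succ hp j)
    refine ⟨ψ', _, d + 1, ?_, hψ', h'', ?_⟩
    · rw [Fin.val_succ] at hd
      rw [Fin.val_castSucc]
      omega
    · rw [setOf_castSucc_le_castSucc, Finset.coe_erase, Set.insert_eq, Set.union_comm,
        Set.compl_union, ← Set.sdiff_eq]
      exact hbij.sdiff_singleton hj

theorem exists_isJordanHolderWith (h : IsEmbeddingFamily p Λ 0 φ)
    (hφ : (ABSub.gen φ).toSubmodule = ⊤) {ν : Fin k → ℂ}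
    (hν : Set.BijOn (twisted ν) Set.univ Λ) :
    ∃ F : Fin (k + 1) → ABSub E, IsJordanHolderWith F ν := by
  have hp (j : Fin k) : IsRankOneHom (twisted ν j) (p (twisted ν j)) :=
    h.hom _ (hν.mapsTo (Set.mem_univ j))
  refine ⟨kerFlag hp, isJordanHolderWith_iff.2 ⟨?_, kerFlag_last hp, kerFlag_castSucc_le_succ hp,
    fun j => commonKer_isNormal _ _, fun j => ?_⟩⟩
  · refine (Submodule.eq_bot_iff _).2 fun x hx => h.eq_zero x (hφ ▸ Submodule.mem_top) ?_
    intro ρ hρ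
    obtain ⟨j, -, rfl⟩ := hν.surjOn hρ
    exact mem_commonKer.1 hx j (Fin.zero_le _)
  · obtain ⟨ψ, Λ', d, hd, hψ, h', hbij⟩ := h.exists_kerFlag_eq_gen hφ hν hp j.succ
    rw [hψ, ← twisted_add_natCast ν hd]
    exact exists_isRankOneQuot_kerFlag hp hψ
      (h'.order_apply _ (hbij.mapsTo (by simp [Fin.le_def])))

end IsEmbeddingFamily

theorem IsTwistedPermutation.bijOn_twisted {ν μ : Fin k → ℂ} (h : IsTwistedPermutation ν μ)
    (hν : Set.BijOn (twisted ν) Set.univ Λ) : Set.BijOn (twisted μ) Set.univ Λ := by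
  obtain ⟨σ, hσ⟩ := h
  have twisted_eq : twisted μ = twisted ν ∘ σ := funext fun j => by simp [twisted, hσ]
  rw [twisted_eq]
  exact hν.comp (Set.bijOn_univ.2 σ.bijective)

theorem IsSemisimple.exists_isJordanHolderWith_of_isTwistedPermutation
    (hφ : (ABSub.gen φ).toSubmodule = ⊤) (h : IsSemisimple E) {F : Fin (k + 1) → ABSub E}
    {ν μ : Fin k → ℂ} (hF : IsJordanHolderWith F ν) (hμ : IsTwistedPermutation ν μ) :
    ∃ F' : Fin (k + 1) → ABSub E, IsJordanHolderWith F' μ := by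
  obtain ⟨p, Λ, hp⟩ := h.exists_isEmbeddingFamily hφ
  exact hp.exists_isJordanHolderWith hφ (hμ.bijOn_twisted (hp.bijOn_twisted hφ hF))

end JordanHolder

section Extension

variable {E : Type*} [AddCommGroup E] [Module ℂ E] [Module ℂ⟦X⟧ E] [IsScalarTower ℂ ℂ⟦X⟧ E]
  [ABAction E]

namespace IsRankOneQuot

variable {G H : ABSub E} {ν ρ : ℂ} {π : H.toSubmodule →ₗ[ℂ⟦X⟧] ℂ⟦X⟧}
  {p : G.toSubmodule →ₗ[ℂ⟦X⟧] ℂ⟦X⟧}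

theorem exists_linear_extension (hπ : IsRankOneQuot H G ν π)
    (hle : G.toSubmodule ≤ H.toSubmodule) (hp : IsRankOneHom ρ p) :
    ∃ (r : H.toSubmodule →ₗ[ℂ⟦X⟧] ℂ⟦X⟧) (S : ℂ⟦X⟧),
      (∀ x, r (Submodule.inclusion hle x) = p x) ∧
      ∀ x, r (a x) = RankOne.aFun ρ (r x) + S * π x := by
  obtain ⟨φ, hφ⟩ := hπ.surjective 1
  -- `H = G ⊕ ℂ⟦X⟧ φ` as a `ℂ⟦X⟧`-module, and `s` is the projection onto `G`.
  let s : H.toSubmodule →ₗ[ℂ⟦X⟧] G.toSubmodule :=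
    (H.toSubmodule.subtype ∘ₗ (LinearMap.id - π.smulRight φ)).codRestrict G.toSubmodule fun x =>
      (hπ.apply_eq_zero_iff (x - π x • φ)).1 (by simp [hφ])
  have coe_s (x) : (s x : E) = x - π x • (φ : E) := rfl
  have hs_add (x) : Submodule.inclusion hle (s x) + π x • φ = x := Subtype.ext (by simp [coe_s])
  have hsφ : s φ = 0 := Subtype.ext (by simp [coe_s, hφ])
  have hs_incl (x) : s (Submodule.inclusion hle x) = x := by
    have hπx : π (Submodule.inclusion hle x) = 0 := (hπ.apply_eq_zero_iff _).2 x.2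
    exact Subtype.ext (by simp [coe_s, hπx])
  have hs_a (x) : s (a x) = a (s x) + π x • s (a φ) := by
    conv_lhs => rw [← hs_add x, map_add, ABAction.a_smul]
    rw [map_add, map_add, map_smul, map_smul, hsφ, smul_zero, add_zero]
    exact congrArg (· + _) (hs_incl (a (s x)))
  refine ⟨p ∘ₗ s, p (s (a φ)), fun x => congrArg p (hs_incl x), fun x => ?_⟩
  change p (s (a x)) = RankOne.aFun ρ (p (s x)) + p (s (a φ)) * π x
  rw [hs_a, map_add, map_smul, hp, smul_eq_mul, mul_comm]

theorem exists_extension (hπ : IsRankOneQuot H G ν π) (hle : G.toSubmodule ≤ H.toSubmodule)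
    (hp : IsRankOneHom ρ p) (hρ : ∀ n : ℕ, n + (ρ - 1) ≠ ν) :
    ∃ q : H.toSubmodule →ₗ[ℂ⟦X⟧] ℂ⟦X⟧, IsRankOneHom (ρ - 1) q ∧
      ∀ x, q (Submodule.inclusion hle x) = X * p x := by
  obtain ⟨r, S, hrp, hra⟩ := hπ.exists_linear_extension hle hp
  -- The equation on `u` says exactly that `X r + u π` commutes with `a`.
  obtain ⟨u, hu⟩ := RankOne.exists_aFun_eq_add hρ S
  refine ⟨(X : ℂ⟦X⟧) • r + u • π, fun x => ?_, fun x => ?_⟩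
  · have aFun_X_mul : RankOne.aFun (ρ - 1) (X * r x) = X * RankOne.aFun ρ (r x) := by
      simpa using RankOne.aFun_X_pow_mul (ρ - 1) 1 (r x)
    change X * r (a x) + u * π (a x) = RankOne.aFun (ρ - 1) (X * r x + u * π x)
    rw [map_add, aFun_X_mul, mul_comm u (π x), RankOne.aFun_mul, hu, hra, hπ.hom,
      RankOne.aFun_apply ν]
    ring
  · have hπx : π (Submodule.inclusion hle x) = 0 := (hπ.apply_eq_zero_iff _).2 x.2
    simp [hrp, hπx]

end IsRankOneQuot

/-- `E` is separated by finitely many morphisms to modules `E_ρ`, `ρ ∈ s` (repetitions of `ρ` are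
allowed), that is, it embeds in a finite direct sum of such modules. -/
def IsSeparatedBy (E : Type*) [AddCommGroup E] [Module ℂ E] [Module ℂ⟦X⟧ E]
    [IsScalarTower ℂ ℂ⟦X⟧ E] [ABAction E] (s : Set ℂ) : Prop :=
  ∃ (n : ℕ) (ρ : Fin n → ℂ) (q : Fin n → E →ₗ[ℂ⟦X⟧] ℂ⟦X⟧),
    (∀ i, ρ i ∈ s ∧ IsRankOneHom (ρ i) (q i)) ∧ ∀ x, (∀ i, q i x = 0) → x = 0

theorem IsSeparatedBy.of_isRankOneQuot {G H : ABSub E} {s t : Set ℂ} {ν : ℂ}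
    {π : H.toSubmodule →ₗ[ℂ⟦X⟧] ℂ⟦X⟧} (hG : IsSeparatedBy G.toSubmodule s)
    (hπ : IsRankOneQuot H G ν π) (hle : G.toSubmodule ≤ H.toSubmodule)
    (hs : ∀ ρ ∈ s, ∀ n : ℕ, n + (ρ - 1) ≠ ν) (hν : ν ∈ t) (ht : ∀ ρ ∈ s, ρ - 1 ∈ t) :
    IsSeparatedBy H.toSubmodule t := by
  obtain ⟨n, ρ, p, hp, hp0⟩ := hG
  choose q hq hqp using fun i => hπ.exists_extension hle (hp i).2 (hs _ (hp i).1)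
  refine ⟨n + 1, Fin.cons ν (ρ · - 1), Fin.cons π q, ?_, fun x hx => ?_⟩
  · exact Fin.forall_fin_succ.2 ⟨⟨hν, hπ.hom⟩, fun i => ⟨ht _ (hp i).1, hq i⟩⟩
  · obtain ⟨hπx, hqx⟩ := Fin.forall_fin_succ.1 hx
    obtain ⟨y, rfl⟩ : ∃ y, Submodule.inclusion hle y = x :=
      ⟨⟨x, (hπ.apply_eq_zero_iff x).1 hπx⟩, rfl⟩
    have hy : y = 0 := hp0 y fun i => by
      simpa [hqp, X_ne_zero] using hqx i
    rw [hy, map_zero]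

theorem isSemisimple_of_isJordanHolderWith {k : ℕ} {F : Fin (k + 1) → ABSub E} {μ : Fin k → ℂ}
    (hF : IsJordanHolderWith F μ) (hμ : ∀ i j, i < j → ∀ n : ℕ, n + twisted μ i ≠ twisted μ j) :
    IsSemisimple E := by
  obtain ⟨h0, h1, hle, -, hquot⟩ := isJordanHolderWith_iff.1 hF
  have isSeparatedBy (j : Fin (k + 1)) : IsSeparatedBy (F j).toSubmodule
      {ρ | ∃ i : Fin k, i.castSucc < j ∧ ρ = twisted μ i + (k - j)} := by
    induction j using Fin.induction with
    | zero =>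
      exact ⟨0, 0, 0, finZeroElim, fun x _ => Subtype.ext ((Submodule.mem_bot _).1 (h0.le x.2))⟩
    | succ j ih =>
      obtain ⟨π, hπ⟩ := hquot j
      have hμj : μ j = twisted μ j + (k - (j + 1)) := by
        rw [twisted]
        ring
      refine ih.of_isRankOneQuot hπ (hle j) ?_ ⟨j, Fin.castSucc_lt_succ, by simpa using hμj⟩ ?_
      · rintro _ ⟨i, hij, rfl⟩ n hn
        refine hμ i j (Fin.castSucc_lt_castSucc_iff.1 hij) n ?_
        rw [hμj, Fin.val_castSucc] at hn
        linear_combination hn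
      · rintro _ ⟨i, hij, rfl⟩
        refine ⟨i, hij.trans Fin.castSucc_lt_succ, ?_⟩
        push_cast [Fin.val_castSucc, Fin.val_succ]
        ring
  obtain ⟨n, ρ, q, hq, hq0⟩ := isSeparatedBy (Fin.last k)
  let toLast : E →ₗ[ℂ⟦X⟧] (F (Fin.last k)).toSubmodule :=
    LinearMap.id.codRestrict _ fun x => h1 ▸ Submodule.mem_top
  exact isSemisimple_of_isRankOneHom (p := fun i => q i ∘ₗ toLast) (fun i x => (hq i).2 (toLast x))
    fun x hx => congrArg Subtype.val (hq0 (toLast x) hx)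

end Extension

section Fresco

namespace Xi

variable {Λ : Finset ℚ} {N p : ℕ} {f : Xi Λ N p}

theorem a_apply_of_forall_gt_eq_zero {l : Λ} {j : Fin (N + 1)} {v : Fin p}
    (hf : ∀ i > j, f l i v = 0) :
    (a f : Xi Λ N p) l j v = RankOne.aFun ((l : ℚ) : ℂ) (f l j v) := by
  change Xi.aFun Λ N p f l j v = _
  rw [RankOne.aFun_apply]
  refine add_eq_left.2 ?_
  split_ifs with hj
  · rw [hf ⟨j + 1, hj⟩ (Nat.lt_succ_self j), mul_zero, mul_zero]
  · rfl

theorem exists_apply_ne_zero (hf : f ≠ 0) :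
    ∃ l j v, f l j v ≠ 0 ∧ ∀ i > j, f l i v = 0 := by
  classical
  have exists_ne_zero : ∃ l v, ∃ j, f l j v ≠ 0 := by
    by_contra! h
    exact hf (funext fun l => funext fun j => funext fun v => h l v j)
  obtain ⟨l, v, j₀, hj₀⟩ := exists_ne_zero
  obtain ⟨j, hj, hmax⟩ := (Finset.univ.filter fun j => f l j v ≠ 0).exists_max_image id
    ⟨j₀, by simpa using hj₀⟩
  refine ⟨l, j, v, (Finset.mem_filter.1 hj).2, fun i hi => ?_⟩
  by_contra h
  exact hi.not_ge (hmax i (by simpa using h))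

theorem exists_constantCoeff_eq_ratCast (hf : f ≠ 0) {T : ℂ⟦X⟧} (hT : a f = (X * T) • f) :
    ∃ r : ℚ, constantCoeff T = r := by
  obtain ⟨l, j, v, hlj, hgt⟩ := exists_apply_ne_zero hf
  obtain ⟨n, hn⟩ := exists_order_eq_natCast hlj
  have hcoord : RankOne.aFun ((l : ℚ) : ℂ) (f l j v) = X * T * f l j v := by
    rw [← a_apply_of_forall_gt_eq_zero hgt, hT]
    rfl
  exact ⟨l + n, by simpa using RankOne.constantCoeff_eq_of_aFun_eq hn hcoord⟩

end Xi

variable {E : Type*} [AddCommGroup E] [Module ℂ E] [Module ℂ⟦X⟧ E] [IsScalarTower ℂ ℂ⟦X⟧ E]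
  [ABAction E]

namespace IsFresco

theorem exists_hom_and_generator (hE : IsFresco E) :
    ∃ (Λ : Finset ℚ) (N p : ℕ) (f : E →ₗ[ℂ⟦X⟧] Xi Λ N p) (φ : E), (∀ x, f (a x) = a (f x)) ∧
      Function.Injective f ∧ (ABSub.gen φ).toSubmodule = ⊤ := by
  obtain ⟨Λ, N, p, φ, -, ⟨e⟩⟩ := hE
  let f := (ABSub.gen φ).toSubmodule.subtype ∘ₗ e.toLinearEquiv.toLinearMap
  have hf (x) : f (a x) = a (f x) := congrArg Subtype.val (e.map_a x)
  have f_injective : Function.Injective f :=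
    Subtype.val_injective.comp e.toLinearEquiv.injective
  refine ⟨Λ, N, p, f, e.toLinearEquiv.symm ⟨φ, ABSub.mem_gen φ⟩, hf, f_injective,
    ABSub.gen_eq_top_of_range_le hf f_injective ?_⟩
  rintro _ ⟨x, rfl⟩
  simp [f]

theorem exists_generator (hE : IsFresco E) : ∃ φ : E, (ABSub.gen φ).toSubmodule = ⊤ := by
  obtain ⟨-, -, -, -, φ, -, -, hφ⟩ := hE.exists_hom_and_generator
  exact ⟨φ, hφ⟩

theorem exists_constantCoeff_eq_ratCast (hE : IsFresco E) {x : E} (hx : x ≠ 0) {T : ℂ⟦X⟧}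
    (hT : a x = (X * T) • x) : ∃ r : ℚ, constantCoeff T = r := by
  obtain ⟨Λ, N, p, f, -, hf, f_injective, -⟩ := hE.exists_hom_and_generator
  exact Xi.exists_constantCoeff_eq_ratCast ((map_ne_zero_iff f f_injective).2 hx)
    (by rw [← hf, hT, map_smul])

end IsFresco

variable {p : ℂ → E →ₗ[ℂ⟦X⟧] ℂ⟦X⟧} {Λ : Finset ℂ} {φ : E} {d : ℕ}

theorem IsEmbeddingFamily.exists_a_eq_smul (h : IsEmbeddingFamily p Λ d φ) {ρ : ℂ} (hρ : ρ ∈ Λ) :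
    ∃ (x : E) (T : ℂ⟦X⟧) (n : ℕ), x ≠ 0 ∧ a x = (X * T) • x ∧ constantCoeff T = ρ + n := by
  obtain ⟨x, hx, hpρx, hpσx⟩ := h.exists_apply_ne_zero (h.hom ρ hρ) (h.order_apply ρ hρ)
  obtain ⟨n, hn⟩ := exists_order_eq_natCast hpρx
  obtain ⟨T, hT, hpT⟩ := RankOne.exists_aFun_eq_mul_self ρ hn
  refine ⟨x, T, n, fun hx0 => hpρx (hx0 ▸ map_zero (p ρ)), sub_eq_zero.1 ?_, hT⟩
  refine h.eq_zero _ ((ABSub.gen φ).a_sub_smul_mem _ hx) fun σ hσ => ?_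
  rw [(h.hom σ hσ).apply_a_sub]
  rcases eq_or_ne σ ρ with rfl | hσρ
  · rw [hpT, sub_self]
  · rw [hpσx σ hσ hσρ, map_zero, mul_zero, sub_zero]

theorem IsFresco.exists_ratCast_eq (hE : IsFresco E) (h : IsEmbeddingFamily p Λ d φ) {ρ : ℂ}
    (hρ : ρ ∈ Λ) : ∃ r : ℚ, (r : ℂ) = ρ := by
  obtain ⟨x, T, n, hx, hax, hT⟩ := h.exists_a_eq_smul hρ
  obtain ⟨r, hr⟩ := hE.exists_constantCoeff_eq_ratCast hx hax
  exact ⟨r - n, by push_cast; linear_combination hT - hr⟩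

theorem exists_strictAnti_bijOn_twisted (hΛ : ∀ ρ ∈ Λ, ∃ r : ℚ, (r : ℂ) = ρ) :
    ∃ (k : ℕ) (μ : Fin k → ℚ), StrictAnti (fun j => μ j + ((j : ℕ) + 1 : ℚ)) ∧
      Set.BijOn (twisted fun j => (μ j : ℂ)) Set.univ Λ := by
  have subset_image : (Λ : Set ℂ) ⊆ ((↑) : ℚ → ℂ) '' Set.univ := by simpa [Set.subset_def] using hΛ
  obtain ⟨Q, -, rfl⟩ := Finset.subset_set_image_iff.1 subset_image
  let e := Q.orderEmbOfFin rfl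
  let μ (j : Fin Q.card) : ℚ := e j.rev + Q.card - ((j : ℕ) + 1)
  have twisted_eq : twisted (fun j => (μ j : ℂ)) = (↑) ∘ e ∘ Fin.rev := by
    funext j
    simp [twisted, μ]
  refine ⟨Q.card, μ, fun i j hij => ?_, ?_⟩
  · simpa [μ] using hij
  · have twisted_injective : Function.Injective (twisted fun j => (μ j : ℂ)) :=
      twisted_eq ▸ Rat.cast_injective.comp (e.injective.comp Fin.rev_injective)
    have range_twisted : Set.range (twisted fun j => (μ j : ℂ)) = (Q.image (↑) : Finset ℂ) := by
      rw [twisted_eq, Set.range_comp, Fin.rev_surjective.range_comp, Finset.range_orderEmbOfFin,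
        Finset.coe_image]
    rw [← range_twisted, ← Set.image_univ]
    exact twisted_injective.injOn.bijOn_image

theorem IsFresco.exists_isJordanHolderWith_strictAnti (hE : IsFresco E) (h : IsSemisimple E) :
    ∃ (k : ℕ) (F : Fin (k + 1) → ABSub E) (μ : Fin k → ℚ),
      IsJordanHolderWith F (fun j => (μ j : ℂ)) ∧
      StrictAnti (fun j : Fin k => μ j + ((j : ℕ) + 1 : ℚ)) := by
  obtain ⟨φ, hφ⟩ := hE.exists_generator
  obtain ⟨p, Λ, hp⟩ := h.exists_isEmbeddingFamily hφ
  obtain ⟨k, μ, hμ, hbij⟩ := exists_strictAnti_bijOn_twisted fun ρ => hE.exists_ratCast_eq hp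
  obtain ⟨F, hF⟩ := hp.exists_isJordanHolderWith hφ hbij
  exact ⟨k, F, μ, hF, hμ⟩

theorem isSemisimple_of_strictAnti {k : ℕ} {F : Fin (k + 1) → ABSub E} {μ : Fin k → ℚ}
    (hF : IsJordanHolderWith F (fun j => (μ j : ℂ)))
    (hμ : StrictAnti (fun j : Fin k => μ j + ((j : ℕ) + 1 : ℚ))) : IsSemisimple E := by
  refine isSemisimple_of_isJordanHolderWith hF fun i j hij n hn => (hμ hij).not_ge ?_
  have hn' : (n : ℚ) + (μ i + ((i : ℕ) + 1)) = μ j + ((j : ℕ) + 1) := by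
    rw [twisted, twisted, ← add_sub_assoc, sub_left_inj] at hn
    exact_mod_cast hn
  exact (le_add_of_nonneg_left n.cast_nonneg).trans_eq hn'

end Fresco

end ABTheory

end

theorem mainTheorem6_general {E : Type*} [AddCommGroup E] [Module ℂ E] [Module ℂ⟦X⟧ E]
    [IsScalarTower ℂ ℂ⟦X⟧ E] [ABTheory.ABAction E] (hE : ABTheory.IsFresco E) :
    (ABTheory.IsSemisimple E ↔
      ∃ (k : ℕ) (F : Fin (k + 1) → ABTheory.ABSub E) (μ : Fin k → ℚ),
        ABTheory.IsJordanHolderWith F (fun j => (μ j : ℂ)) ∧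
        StrictAnti (fun j : Fin k => μ j + ((j : ℕ) + 1 : ℚ))) ∧
    (ABTheory.IsSemisimple E →
      (∃ (k : ℕ) (F : Fin (k + 1) → ABTheory.ABSub E) (ν : Fin k → ℂ),
        ABTheory.IsJordanHolderWith F ν) ∧
      ∀ (k : ℕ) (F : Fin (k + 1) → ABTheory.ABSub E) (ν : Fin k → ℂ),
        ABTheory.IsJordanHolderWith F ν →
        ∀ μ : Fin k → ℂ, ABTheory.IsTwistedPermutation ν μ →
          ∃ G : Fin (k + 1) → ABTheory.ABSub E, ABTheory.IsJordanHolderWith G μ) := by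
  refine ⟨⟨hE.exists_isJordanHolderWith_strictAnti, ?_⟩, fun h => ⟨?_, fun k F ν hF μ hμ => ?_⟩⟩
  · rintro ⟨k, F, μ, hF, hμ⟩
    exact ABTheory.isSemisimple_of_strictAnti hF hμ
  · obtain ⟨k, F, μ, hF, -⟩ := hE.exists_isJordanHolderWith_strictAnti h
    exact ⟨k, F, _, hF⟩
  · obtain ⟨φ, hφ⟩ := hE.exists_generator
    exact h.exists_isJordanHolderWith_of_isTwistedPermutation hφ hF hμ

theorem mainTheorem6 {E : Type*} [AddCommGroup E] [Module ℂ E] [Module ℂ⟦X⟧ E]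
    [IsScalarTower ℂ ℂ⟦X⟧ E] [ABTheory.ABAction E] (hE : ABTheory.IsFresco E) :
    (∀ lam : ℚ, 0 < lam → lam ≤ 1 → ABTheory.IsPrimitive E {lam} →
      (ABTheory.IsSemisimple E ↔
        ∃ (k : ℕ) (F : Fin (k + 1) → ABTheory.ABSub E) (μ : Fin k → ℚ),
          ABTheory.IsJordanHolderWith F (fun j => (μ j : ℂ)) ∧
          StrictAnti (fun j : Fin k => μ j + ((j : ℕ) + 1 : ℚ)))) ∧
    (ABTheory.IsSemisimple E →
      (∃ (k : ℕ) (F : Fin (k + 1) → ABTheory.ABSub E) (ν : Fin k → ℂ),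
        ABTheory.IsJordanHolderWith F ν) ∧
      ∀ (k : ℕ) (F : Fin (k + 1) → ABTheory.ABSub E) (ν : Fin k → ℂ),
        ABTheory.IsJordanHolderWith F ν →
        ∀ μ : Fin k → ℂ, ABTheory.IsTwistedPermutation ν μ →
          ∃ G : Fin (k + 1) → ABTheory.ABSub E, ABTheory.IsJordanHolderWith G μ) :=
  ⟨fun _ _ _ _ => (mainTheorem6_general hE).1, (mainTheorem6_general hE).2⟩
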